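/- Let $r>0$. Let $N$ be a Poisson process with intensity $r$ (a counting process with $N(0)=0$ and independent stationary increments, $N(t)$ being Poisson distributed with mean $rt$), and let $W^0,W^1,W^2,\dots$ be independent standard Wiener processes started at $0$, the whole sequence being independent of $N$. Let $\tau_0=0$ and let $\tau_k$ be the time of the $k$-th jump of $N$. The Wiener process under Poissonian resetting to $0$ with intensity $r$ is $X(t)=W^{N(t)}\bigl(t-\tau_{N(t)}\bigr)$, and $$L_r=\sup\{t\in[0,1]: X(t)=0\}$$ is its last zero on $[0,1]$. Write $${}_2\bar F_2(a_1,a_2;b_1,b_2;z)=\frac{1}{\Gamma(b_1)\Gamma(b_2)}\sum_{k=0}^\infty\frac{a_1^{(k)}a_2^{(k)}}{b_1^{(k)}b_2^{(k)}}\frac{z^k}{k!},\qquad x^{(k)}=\prod_{j=0}^{k-1}(x+j),$$ for the regularized generalized hypergeometric function. Then for every $r>0$ all the moments of $L_r$ exist and, for every integer $n\ge 0$, $$\mathbb E[L_r^n]=e^{-r}\left(\frac{\Gamma(\frac12+n)}{\sqrt\pi\,\Gamma(1+n)}+r\,\Gamma(\tfrac32+n)\;{}_2\bar F_2\bigl(1,\tfrac32+n;\tfrac32,2+n;r\bigr)\right).$$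 The mean and the variance of $L_r$ are $$\mathbb E[L_r]=1+\frac{e^{-r}-1}{2r},\qquad \operatorname{Var}(L_r)=\mathbb E[L_r^2]-(\mathbb E[L_r])^2=\frac{2-e^{-r}(1+3r)-e^{-2r}}{4r^2}.$$ Consequently $\mathbb E[L_r]\to\frac12$ as $r\to0^+$, while $\mathbb E[L_r]\to1$ and $\operatorname{Var}(L_r)\to0$ as $r\to\infty$, and $L_r\to1$ in probability as $r\to\infty$; that is, for every $\varepsilon>0$, $\mathbb P(|L_r-1|\ge\varepsilon)\to0$ as $r\to\infty$ (the processes for different $r$ may live on different probability spaces). -/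

import Mathlib

open MeasureTheory ProbabilityTheory Filter Topology
open scoped NNReal

namespace BrownianResetting

/-- `N` is a Poisson process with intensity `r` under `P`: a counting process (almost surely with
nondecreasing, right-continuous, `ℕ`-valued paths) started at `0`, with independent and
stationary increments, such that an increment over an interval of length `t` is Poisson
distributed with mean `r t`. (The subtraction of natural numbers in `hasLaw_increment` is
almost surely not truncated, by monotonicity of the paths.) -/
structure IsPoissonProcess {Ω : Type*} [MeasurableSpace Ω] (N : ℝ≥0 → Ω → ℕ) (r : ℝ≥0)
    (P : Measure Ω) : Prop where
  measurable : ∀ t, Measurable (N t)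
  zero : ∀ᵐ ω ∂P, N 0 ω = 0
  indep : HasIndepIncrements (fun t ω ↦ (N t ω : ℝ)) P
  hasLaw_increment : ∀ s t : ℝ≥0,
    HasLaw (fun ω ↦ N (s + t) ω - N s ω) (poissonMeasure (r * t)) P
  mono : ∀ᵐ ω ∂P, Monotone (fun t ↦ N t ω)
  rightCont : ∀ᵐ ω ∂P, ∀ t : ℝ≥0, ContinuousWithinAt (fun s ↦ N s ω) (Set.Ici t) t

/-- The driving objects of Brownian motion with Poissonian resetting of intensity `r`: a Poisson
process `N` whose jumps are the resetting moments, and a sequence of independent Wiener processes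
`W 0, W 1, …`, one for each interval between consecutive resets, the whole sequence being
independent of `N`. -/
structure IsResettingModel {Ω : Type*} [MeasurableSpace Ω] (W : ℕ → ℝ≥0 → Ω → ℝ)
    (N : ℝ≥0 → Ω → ℕ) (r : ℝ≥0) (P : Measure Ω) : Prop where
  poisson : IsPoissonProcess N r P
  brownian : ∀ k, IsBrownianReal (W k) P
  measurable : ∀ k t, Measurable (W k t)
  iIndep : iIndepFun (fun k ω t ↦ W k t ω) P
  indep : IndepFun (fun ω k t ↦ W k t ω) (fun ω t ↦ N t ω) P

/-- The time of the `k`-th jump of the counting process `N` (equal to `0` for `k = 0`). -/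
noncomputable def jumpTime {Ω : Type*} (N : ℝ≥0 → Ω → ℕ) (k : ℕ) (ω : Ω) : ℝ≥0 :=
  sInf {t : ℝ≥0 | k ≤ N t ω}

/-- The Wiener process under resetting to `0`: at time `t` the time elapsed since the last reset
is `t - jumpTime N (N t ω) ω`, and the process has followed the Wiener process `W (N t ω)`,
started at `0`, since then. -/
noncomputable def resetProcess {Ω : Type*} (W : ℕ → ℝ≥0 → Ω → ℝ) (N : ℝ≥0 → Ω → ℕ)
    (t : ℝ≥0) (ω : Ω) : ℝ :=
  W (N t ω) (t - jumpTime N (N t ω) ω) ω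

/-- The last zero of a process `X` on the time interval `[0, 1]`. -/
noncomputable def lastZero {Ω : Type*} (X : ℝ≥0 → Ω → ℝ) (ω : Ω) : ℝ :=
  ((sSup {t : ℝ≥0 | t ≤ 1 ∧ X t ω = 0} : ℝ≥0) : ℝ)

end BrownianResetting

/-! Only the last reset matters. Let T be the last jump of N in [0,1], with T = 0 if there is none.
On [T,1] the process is a single Brownian path restarted from 0 at time T, so T is itself a zero and
L is T plus the last zero of that path on [0,1-T], whatever happened before T
(`IsResettingModel.lastZero_ae_eq`). The event T ≤ t means that N has no jump in (t,1], so T has an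
atom of mass exp(-r) at 0 and density r exp(-r(1-c)) on (0,1) (`IsPoissonProcess.map_lastReset`).
Given T = c, Lévy's arcsine law (`map_lastZeroBefore`) gives L the density 1/(π√((y-c)(1-y))) on
(c,1). Since N is independent of the Brownian paths, the law of L is the mixture of these
(`IsResettingModel.lintegral_lastZero`).

The arcsine law comes from reflection: a path positive at s has a zero in [s,u] with twice the
probability of being positive at s and negative at u (`measure_pos_exists_zero`). That quadrant
probability of a Gaussian pair is an angle, which produces the arctangent in `measure_exists_zero`.

For the moments, the atom contributes one Beta integral. On the density part exp(rc) is expanded in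
powers of c; by Tonelli each term is a product of two Beta integrals
(`lintegral_pow_mul_arcsineExpectation`), and the resulting series is the hypergeometric one
(`ofReal_momentCoeff`). For n = 1, 2 the Gamma quotients are polynomials in k over factorials, so
the series collapse to tails of the exponential series. This gives the mean and variance, hence
their limits, and Markov's inequality for 1 - L gives convergence in probability. -/

namespace BrownianResetting

/-! ### Discrete reflection principle along a grid of times. -/

section Reflection

variable {Ω : Type*}

/-- The event that `B` starts above `a` on the grid `t` and is below `a` for the first time at
the grid point `t i`. -/
def firstBelow (B : ℝ≥0 → Ω → ℝ) (t : ℕ → ℝ≥0) (a : ℝ) (i : ℕ) : Set Ω :=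
  {ω | a < B (t 0) ω ∧ B (t i) ω < a ∧ ∀ j < i, a ≤ B (t j) ω}

lemma disjoint_firstBelow (B : ℝ≥0 → Ω → ℝ) (t : ℕ → ℝ≥0) (a : ℝ) {i j : ℕ} (hij : i ≠ j) :
    Disjoint (firstBelow B t a i) (firstBelow B t a j) := by
  rw [Set.disjoint_left]
  rintro ω ⟨-, h1, h2⟩ ⟨-, h3, h4⟩
  rcases lt_or_gt_of_ne hij with h | h
  · exact absurd (h4 i h) (not_le.2 h1)
  · exact absurd (h2 j h) (not_le.2 h3)

variable [MeasurableSpace Ω] {P : Measure Ω} {B : ℝ≥0 → Ω → ℝ}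

lemma gaussianReal_Iio_eq_Ioi (v : ℝ≥0) :
    gaussianReal 0 v (Set.Iio 0) = gaussianReal 0 v (Set.Ioi 0) := by
  have h := gaussianReal_map_neg (μ := 0) (v := v)
  rw [neg_zero] at h
  conv_lhs => rw [← h]
  rw [Measure.map_apply measurable_neg measurableSet_Iio]
  simp

/-- This bound and the next replace the exact value 1/2 by inequalities that survive variance 0,
where the law is a point mass at 0. That case occurs when the passage happens at the terminal time
itself. -/
lemma two_mul_gaussianReal_Iio_le (v : ℝ≥0) : 2 * gaussianReal 0 v (Set.Iio 0) ≤ 1 := by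
  have h : gaussianReal 0 v (Set.Iio 0 ∪ Set.Ioi 0) ≤ 1 := prob_le_one
  rwa [measure_union (by rw [Set.disjoint_left]; intro x hx; simp at hx ⊢; exact hx.le)
    measurableSet_Ioi, ← gaussianReal_Iio_eq_Ioi, ← two_mul] at h

lemma one_le_two_mul_gaussianReal_Iic (v : ℝ≥0) : 1 ≤ 2 * gaussianReal 0 v (Set.Iic 0) := by
  have h : gaussianReal 0 v (Set.Iic 0 ∪ Set.Ioi 0) = 1 := by
    rw [Set.Iic_union_Ioi]; exact measure_univ
  rw [← h, two_mul]
  refine (measure_union_le _ _).trans ?_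
  rw [← gaussianReal_Iio_eq_Ioi]
  gcongr
  exact Set.Iio_subset_Iic_self

lemma measurableSet_firstBelow (hm : ∀ t, Measurable (B t)) (t : ℕ → ℝ≥0) (a : ℝ) (i : ℕ) :
    MeasurableSet (firstBelow B t a i) := by
  unfold firstBelow
  refine (measurableSet_lt measurable_const (hm _)).inter
    ((measurableSet_lt (hm _) measurable_const).inter ?_)
  have : {ω | ∀ j < i, a ≤ B (t j) ω} = ⋂ j, ⋂ (_ : j < i), {ω | a ≤ B (t j) ω} := by
    ext; simp
  change MeasurableSet {ω | ∀ j < i, a ≤ B (t j) ω}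
  rw [this]
  exact .iInter fun j ↦ .iInter fun _ ↦ measurableSet_le measurable_const (hm _)

/-- The increments of a Brownian motion after a grid point are independent of the first passage
at this point. -/
lemma measure_firstBelow_inter (hB : IsPreBrownianReal B P) (hm : ∀ t, Measurable (B t))
    {t : ℕ → ℝ≥0} (ht : Monotone t) (a : ℝ) (i : ℕ) {u : ℝ≥0} (hu : t i ≤ u) {S : Set ℝ}
    (hS : MeasurableSet S) :
    P (firstBelow B t a i ∩ {ω | B u ω - B (t i) ω ∈ S}) =
      P (firstBelow B t a i) * gaussianReal 0 (u - t i) S := by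
  have hind := hB.indepFun_shift (t i)
  have hmeas : MeasurableSet {x : Set.Iic (t i) → ℝ | a < x ⟨t 0, ht (Nat.zero_le i)⟩ ∧
      x ⟨t i, Set.self_mem_Iic⟩ < a ∧ ∀ j : Set.Iio i, a ≤ x ⟨t j, ht j.2.le⟩} := by
    refine (measurableSet_lt measurable_const (measurable_pi_apply _)).inter
      ((measurableSet_lt (measurable_pi_apply _) measurable_const).inter ?_)
    have : {x : Set.Iic (t i) → ℝ | ∀ j : Set.Iio i, a ≤ x ⟨t j, ht j.2.le⟩} =
        ⋂ j : Set.Iio i, {x | a ≤ x ⟨t j, ht j.2.le⟩} := by ext; simp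
    change MeasurableSet {x : Set.Iic (t i) → ℝ | ∀ j : Set.Iio i, a ≤ x ⟨t j, ht j.2.le⟩}
    rw [this]
    exact .iInter fun j ↦ measurableSet_le measurable_const (measurable_pi_apply _)
  have key := hind.measure_inter_preimage_eq_mul _ _
    (hS.preimage (measurable_pi_apply (u - t i))) hmeas
  have h1 : (fun ω t' ↦ B (t i + t') ω - B (t i) ω) ⁻¹' ((fun f : ℝ≥0 → ℝ ↦ f (u - t i)) ⁻¹' S)
      = {ω | B u ω - B (t i) ω ∈ S} := by
    ext ω; simp [add_tsub_cancel_of_le hu]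
  have h2 : (fun ω (t' : Set.Iic (t i)) ↦ B t' ω) ⁻¹' {x : Set.Iic (t i) → ℝ |
      a < x ⟨t 0, ht (Nat.zero_le i)⟩ ∧
      x ⟨t i, Set.self_mem_Iic⟩ < a ∧ ∀ j : Set.Iio i, a ≤ x ⟨t j, ht j.2.le⟩} = firstBelow B t a i := by
    ext ω; simp [firstBelow]
  have hlaw : P {ω | B u ω - B (t i) ω ∈ S} = gaussianReal 0 (u - t i) S := by
    have := ((hB.shift (t i)).hasLaw_eval (u - t i)).map_eq
    rw [← this, Measure.map_apply (by fun_prop) hS]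
    simp [add_tsub_cancel_of_le hu, Set.preimage]
  rw [h1, h2, hlaw] at key
  rw [Set.inter_comm, key, mul_comm]

/-- From the passage point the later increment is nonpositive with probability at least 1/2. The
value at the passage is strictly below `a`, so a nonpositive increment keeps the path strictly
below. -/
lemma measure_firstBelow_le (hB : IsPreBrownianReal B P) (hm : ∀ t, Measurable (B t))
    {t : ℕ → ℝ≥0} (ht : Monotone t) (a : ℝ) (i : ℕ) {u : ℝ≥0} (hu : t i ≤ u) :
    P (firstBelow B t a i) ≤ 2 * P (firstBelow B t a i ∩ {ω | B u ω < a}) := by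
  have h := measure_firstBelow_inter hB hm ht a i hu (measurableSet_Iic (a := 0))
  calc P (firstBelow B t a i)
      ≤ P (firstBelow B t a i) * (2 * gaussianReal 0 (u - t i) (Set.Iic 0)) :=
        le_mul_of_one_le_right' (one_le_two_mul_gaussianReal_Iic _)
    _ = 2 * P (firstBelow B t a i ∩ {ω | B u ω - B (t i) ω ∈ Set.Iic 0}) := by rw [h]; ring
    _ ≤ _ := by
      refine mul_le_mul_right (measure_mono ?_) _
      rintro ω ⟨h1, h2⟩
      refine ⟨h1, ?_⟩
      simp only [Set.mem_ofPred_eq, Set.mem_Iic] at h2 ⊢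
      linarith [h1.2.1]

/-- The converse estimate: a strictly negative increment after the passage has probability at most
1/2. -/
lemma two_mul_measure_firstBelow_inter_le (hB : IsPreBrownianReal B P)
    (hm : ∀ t, Measurable (B t))
    {t : ℕ → ℝ≥0} (ht : Monotone t) (a : ℝ) (i : ℕ) {u : ℝ≥0} (hu : t i ≤ u) :
    2 * P (firstBelow B t a i ∩ {ω | B u ω < B (t i) ω}) ≤ P (firstBelow B t a i) := by
  have h := measure_firstBelow_inter hB hm ht a i hu (measurableSet_Iio (a := 0))
  simp only [Set.mem_Iio, sub_neg] at h
  rw [h, mul_left_comm]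
  exact mul_le_of_le_one_right' (two_mul_gaussianReal_Iio_le _)

lemma measure_biUnion_firstBelow (hm : ∀ t, Measurable (B t)) (t : ℕ → ℝ≥0) (a : ℝ) (n : ℕ)
    {S : ℕ → Set Ω} (hS : ∀ i, MeasurableSet (S i)) :
    P (⋃ i ∈ Finset.range n, firstBelow B t a i ∩ S i) =
      ∑ i ∈ Finset.range n, P (firstBelow B t a i ∩ S i) :=
  measure_biUnion_finset
    (fun _ _ _ _ hij ↦ (disjoint_firstBelow B t a hij).mono Set.inter_subset_left
      Set.inter_subset_left)
    fun i _ ↦ (measurableSet_firstBelow hm t a i).inter (hS i)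

/-- The discrete reflection principle, upper bound. -/
lemma measure_exists_grid_lt_le (hB : IsPreBrownianReal B P) (hm : ∀ t, Measurable (B t))
    {t : ℕ → ℝ≥0} (ht : Monotone t) (a : ℝ) (n : ℕ) {u : ℝ≥0} (hu : t n ≤ u) :
    P {ω | a < B (t 0) ω ∧ ∃ i ≤ n, B (t i) ω < a} ≤
      2 * P {ω | a < B (t 0) ω ∧ B u ω < a} := by
  have hsub : {ω | a < B (t 0) ω ∧ ∃ i ≤ n, B (t i) ω < a} ⊆
      ⋃ i ∈ Finset.range (n + 1), firstBelow B t a i := by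
    rintro ω ⟨h0, h1⟩
    classical
    have h2 : ∃ i, B (t i) ω < a := ⟨h1.choose, h1.choose_spec.2⟩
    obtain ⟨i, hi, hia⟩ := h1
    simp only [Finset.mem_range, Set.mem_iUnion, exists_prop]
    exact ⟨Nat.find h2, ((Nat.find_le hia).trans hi).trans_lt (Nat.lt_succ_self n), h0,
      Nat.find_spec h2, fun j hj ↦ not_lt.1 (Nat.find_min h2 hj)⟩
  calc _ ≤ P (⋃ i ∈ Finset.range (n + 1), firstBelow B t a i) := measure_mono hsub
    _ ≤ ∑ i ∈ Finset.range (n + 1), P (firstBelow B t a i) := measure_biUnion_finset_le _ _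
    _ ≤ ∑ i ∈ Finset.range (n + 1), 2 * P (firstBelow B t a i ∩ {ω | B u ω < a}) := by
      refine Finset.sum_le_sum fun i hi ↦ measure_firstBelow_le hB hm ht a i
        ((ht ?_).trans hu)
      simpa [Nat.lt_succ_iff] using hi
    _ = 2 * P (⋃ i ∈ Finset.range (n + 1), firstBelow B t a i ∩ {ω | B u ω < a}) := by
      rw [measure_biUnion_firstBelow hm t a _ fun _ ↦ measurableSet_lt (hm _) measurable_const,
        Finset.mul_sum]
    _ ≤ _ := by
      gcongr
      simp only [Set.iUnion_subset_iff]
      rintro i - ω ⟨h1, h2⟩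
      exact ⟨h1.1, h2⟩

/-- The discrete reflection principle, lower bound up to the overshoot. -/
lemma two_mul_measure_le_exists_grid_lt (hB : IsPreBrownianReal B P)
    (hm : ∀ t, Measurable (B t))
    {t : ℕ → ℝ≥0} (ht : Monotone t) (a δ : ℝ) (n : ℕ) (hδ : 0 ≤ δ) :
    2 * P {ω | a < B (t 0) ω ∧ B (t n) ω < a - δ} ≤
      P {ω | a < B (t 0) ω ∧ ∃ i ≤ n, B (t i) ω < a} +
      2 * P {ω | ∃ i < n, B (t (i + 1)) ω < B (t i) ω - δ} := by
  have hsub : {ω | a < B (t 0) ω ∧ B (t n) ω < a - δ} ⊆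
      (⋃ i ∈ Finset.range (n + 1), firstBelow B t a i ∩ {ω | B (t n) ω < B (t i) ω}) ∪
        {ω | ∃ i < n, B (t (i + 1)) ω < B (t i) ω - δ} := by
    rintro ω ⟨h0, h1⟩
    classical
    have h2 : ∃ i, B (t i) ω < a := ⟨n, by linarith⟩
    -- If the first value below `a` is already below `a - δ`, one grid step has dropped by more than
    -- `δ`. Otherwise the terminal value lies strictly below the value at the passage.
    by_cases h3 : B (t (Nat.find h2)) ω < a - δ
    · right
      have h4 : Nat.find h2 ≠ 0 := by
        intro h4
        have := Nat.find_spec h2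
        rw [h4] at this
        exact lt_asymm this h0
      obtain ⟨j, hj⟩ := Nat.exists_eq_succ_of_ne_zero h4
      refine ⟨j, ?_, ?_⟩
      · have : Nat.find h2 ≤ n := Nat.find_le (by linarith)
        omega
      · have h5 := Nat.find_min h2 (m := j) (by omega)
        rw [hj] at h3
        linarith
    · left
      simp only [Finset.mem_range, Set.mem_iUnion, exists_prop]
      refine ⟨Nat.find h2, Nat.lt_succ_of_le (Nat.find_le (by linarith)),
        ⟨h0, Nat.find_spec h2, fun j hj ↦ not_lt.1 (Nat.find_min h2 hj)⟩, ?_⟩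
      simp only [Set.mem_ofPred_eq]
      linarith
  calc _ ≤ 2 * (P (⋃ i ∈ Finset.range (n + 1),
        firstBelow B t a i ∩ {ω | B (t n) ω < B (t i) ω}) +
        P {ω | ∃ i < n, B (t (i + 1)) ω < B (t i) ω - δ}) := by
        gcongr
        exact (measure_mono hsub).trans (measure_union_le _ _)
    _ ≤ _ := by
      rw [mul_add]
      gcongr
      rw [measure_biUnion_firstBelow hm t a _ fun i ↦ measurableSet_lt (hm _) (hm _),
        Finset.mul_sum]
      calc _ ≤ ∑ i ∈ Finset.range (n + 1), P (firstBelow B t a i) := by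
            refine Finset.sum_le_sum fun i hi ↦ two_mul_measure_firstBelow_inter_le hB hm ht a i
              (ht ?_)
            simpa [Nat.lt_succ_iff] using hi
        _ = P (⋃ i ∈ Finset.range (n + 1), firstBelow B t a i) := by
            simpa using (measure_biUnion_firstBelow (P := P) hm t a (n + 1)
              fun _ ↦ MeasurableSet.univ).symm
        _ ≤ _ := by
            refine measure_mono ?_
            simp only [Set.iUnion_subset_iff]
            rintro i hi ω h1
            exact ⟨h1.1, i, by simpa [Nat.lt_succ_iff] using hi, h1.2.1⟩

end Reflection

/-! ### From grids to continuous paths: reflection for zeros in an interval. -/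

section ZeroProbability

/-- The dyadic grid of mesh `(u - s) / 2 ^ n` started at `s`. -/
noncomputable def dyadicGrid (s u : ℝ≥0) (n i : ℕ) : ℝ≥0 := s + (u - s) * (i / 2 ^ n)

lemma dyadicGrid_zero (s u : ℝ≥0) (n : ℕ) : dyadicGrid s u n 0 = s := by simp [dyadicGrid]

lemma dyadicGrid_last {s u : ℝ≥0} (hsu : s ≤ u) (n : ℕ) : dyadicGrid s u n (2 ^ n) = u := by
  have : ((2 ^ n : ℕ) : ℝ≥0) / 2 ^ n = 1 := by
    push_cast; exact div_self (by positivity)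
  rw [dyadicGrid, this, mul_one, add_tsub_cancel_of_le hsu]

lemma monotone_dyadicGrid (s u : ℝ≥0) (n : ℕ) : Monotone (dyadicGrid s u n) := by
  intro i j hij
  unfold dyadicGrid
  gcongr

/-- The grids are nested, so the passage events in `measure_exists_lt_le` increase with the level
and continuity from below applies. -/
lemma dyadicGrid_succ (s u : ℝ≥0) (n i : ℕ) :
    dyadicGrid s u (n + 1) (2 * i) = dyadicGrid s u n i := by
  unfold dyadicGrid
  congr 2
  rw [pow_succ]
  push_cast
  field_simp

lemma dyadicGrid_mem {s u : ℝ≥0} (hsu : s ≤ u) {n i : ℕ} (hi : i ≤ 2 ^ n) :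
    dyadicGrid s u n i ∈ Set.Icc s u :=
  ⟨le_self_add, (monotone_dyadicGrid s u n hi).trans (dyadicGrid_last hsu n).le⟩

lemma exists_dyadicGrid_tendsto {s u t : ℝ≥0} (ht : t ∈ Set.Icc s u) :
    ∃ i : ℕ → ℕ, (∀ n, i n ≤ 2 ^ n) ∧
      Tendsto (fun n ↦ dyadicGrid s u n (i n)) atTop (𝓝 t) := by
  obtain ⟨x, hx, hxt⟩ : ∃ x : ℝ≥0, x ≤ 1 ∧ t = s + (u - s) * x := by
    rcases eq_or_ne u s with h | h
    · exact ⟨0, zero_le_one, by subst h; simpa using le_antisymm ht.2 ht.1⟩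
    · have hsu : s < u := lt_of_le_of_ne (ht.1.trans ht.2) h.symm
      have hpos : 0 < u - s := tsub_pos_of_lt hsu
      refine ⟨(t - s) / (u - s), div_le_one_of_le₀ (tsub_le_tsub_right ht.2 s) (zero_le), ?_⟩
      rw [mul_div_cancel₀ _ hpos.ne', add_tsub_cancel_of_le ht.1]
  refine ⟨fun n ↦ ⌊(x : ℝ) * 2 ^ n⌋₊, fun n ↦ ?_, ?_⟩
  · refine Nat.floor_le_of_le ?_
    push_cast
    exact mul_le_of_le_one_left (by positivity) (by exact_mod_cast hx)
  · have h1 : Tendsto (fun n : ℕ ↦ (⌊(x : ℝ) * 2 ^ n⌋₊ : ℝ) / 2 ^ n) atTop (𝓝 x) :=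
      (tendsto_nat_floor_mul_div_atTop (R := ℝ) x.2).comp
        (tendsto_pow_atTop_atTop_of_one_lt (one_lt_two (α := ℝ)))
    have h2 : Tendsto (fun n : ℕ ↦ (⌊(x : ℝ) * 2 ^ n⌋₊ : ℝ≥0) / 2 ^ n) atTop (𝓝 x) := by
      rw [← NNReal.tendsto_coe]
      push_cast
      exact h1
    rw [hxt]
    exact (h2.const_mul _).const_add _

variable {Ω : Type*} [MeasurableSpace Ω] {P : Measure Ω} {B : ℝ≥0 → Ω → ℝ}

/-- The reflection principle, upper bound. -/
lemma measure_exists_lt_le (hB : IsBrownianReal B P) (hm : ∀ t, Measurable (B t))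
    {s u : ℝ≥0} (hsu : s ≤ u) (a : ℝ) :
    P {ω | a < B s ω ∧ ∃ t ∈ Set.Icc s u, B t ω < a} ≤
      2 * P {ω | a < B s ω ∧ B u ω < a} := by
  set E : ℕ → Set Ω := fun n ↦ {ω | a < B s ω ∧ ∃ i ≤ 2 ^ n, B (dyadicGrid s u n i) ω < a}
    with hE
  have hmono : Monotone E := by
    refine monotone_nat_of_le_succ fun n ω ⟨h1, i, hi, h2⟩ ↦ ⟨h1, 2 * i, ?_, ?_⟩
    · rw [pow_succ']; omega
    · rwa [dyadicGrid_succ]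
  have hsub : ∀ᵐ ω ∂P, ω ∈ {ω | a < B s ω ∧ ∃ t ∈ Set.Icc s u, B t ω < a} →
      ω ∈ ⋃ n, E n := by
    filter_upwards [hB.cont] with ω hω ⟨h1, t, ht, h2⟩
    obtain ⟨i, hi, hlim⟩ := exists_dyadicGrid_tendsto ht
    have h3 := ((hω.tendsto t).comp hlim).eventually_lt_const h2
    obtain ⟨n, hn⟩ := h3.exists
    exact Set.mem_iUnion.2 ⟨n, h1, i n, hi n, hn⟩
  calc _ ≤ P (⋃ n, E n) := measure_mono_ae hsub
    _ = ⨆ n, P (E n) := hmono.measure_iUnion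
    _ ≤ _ := by
      refine iSup_le fun n ↦ ?_
      have := measure_exists_grid_lt_le hB.toIsPreBrownianReal hm (monotone_dyadicGrid s u n) a
        (2 ^ n) (dyadicGrid_last hsu n).le
      simpa only [dyadicGrid_zero] using this

/-- Paths are uniformly continuous on the compact interval, so almost surely no grid step drops by
`δ` once the mesh is small. This removes the overshoot term of the discrete lower bound. -/
lemma tendsto_measure_oscillation (hB : IsBrownianReal B P) (hm : ∀ t, Measurable (B t))
    {s u : ℝ≥0} (hsu : s ≤ u) {δ : ℝ} (hδ : 0 < δ) :
    Tendsto (fun n : ℕ ↦ P {ω | ∃ i < 2 ^ n, B (dyadicGrid s u n (i + 1)) ω <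
      B (dyadicGrid s u n i) ω - δ}) atTop (𝓝 0) := by
  have : IsProbabilityMeasure P := hB.isGaussianProcess.isProbabilityMeasure
  rw [← measure_empty (μ := P)]
  refine tendsto_measure_of_ae_tendsto_indicator_of_isFiniteMeasure atTop MeasurableSet.empty
    (fun n ↦ ?_) ?_
  · have : {ω | ∃ i < 2 ^ n, B (dyadicGrid s u n (i + 1)) ω < B (dyadicGrid s u n i) ω - δ} =
        ⋃ i, ⋃ (_ : i < 2 ^ n), {ω | B (dyadicGrid s u n (i + 1)) ω <
          B (dyadicGrid s u n i) ω - δ} := by ext; simp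
    rw [this]
    exact .iUnion fun i ↦ .iUnion fun _ ↦ measurableSet_lt (hm _) ((hm _).sub_const _)
  · filter_upwards [hB.cont] with ω hω
    have huc := (isCompact_Icc (a := s) (b := u)).uniformContinuousOn_of_continuous
      hω.continuousOn
    obtain ⟨ε, hε, h⟩ := Metric.uniformContinuousOn_iff.1 huc δ hδ
    have hlim : Tendsto (fun n : ℕ ↦ ((u - s : ℝ≥0) : ℝ) * (1 / 2) ^ n) atTop (𝓝 0) := by
      simpa using (tendsto_pow_atTop_nhds_zero_of_lt_one (r := (1 / 2 : ℝ)) (by norm_num)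
        (by norm_num)).const_mul ((u - s : ℝ≥0) : ℝ)
    filter_upwards [hlim.eventually_lt_const hε] with n hn
    simp only [Set.mem_empty_iff_false, iff_false, not_exists, not_and, not_lt]
    intro i hi
    have hd := h _ (dyadicGrid_mem hsu (n := n) hi) _ (dyadicGrid_mem hsu (n := n) hi.le) ?_
    · rw [Real.dist_eq] at hd
      linarith [(abs_lt.1 hd).1]
    · rw [NNReal.dist_eq]
      have : ((dyadicGrid s u n (i + 1) : ℝ≥0) : ℝ) - dyadicGrid s u n i =
          ((u - s : ℝ≥0) : ℝ) * (1 / 2) ^ n := by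
        unfold dyadicGrid
        push_cast
        rw [one_div, inv_pow]
        ring
      rw [this, abs_of_nonneg (by positivity)]
      exact hn

lemma measure_eval_eq_zero (hB : IsPreBrownianReal B P) {s : ℝ≥0} (hs : s ≠ 0) :
    P {ω | B s ω = 0} = 0 := by
  have hna := nullSingletonClass_gaussianReal (μ := 0) hs
  have h2 : P.map (B s) {0} = 0 := by
    rw [(hB.hasLaw_eval s).map_eq]; exact measure_singleton _
  rwa [Measure.map_apply_of_aemeasurable (hB.aemeasurable s) (measurableSet_singleton 0)] at h2

lemma tendsto_inv_succ_atTop : Tendsto (fun m : ℕ ↦ 1 / ((m : ℝ) + 1)) atTop (𝓝 0) :=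
  tendsto_one_div_add_atTop_nhds_zero_nat

/-- The reflection principle for the zeros after a time at which `B` is positive. -/
lemma measure_pos_exists_zero (hB : IsBrownianReal B P) (hm : ∀ t, Measurable (B t))
    {s u : ℝ≥0} (hsu : s ≤ u) (hu : u ≠ 0) :
    P {ω | 0 < B s ω ∧ ∃ t ∈ Set.Icc s u, B t ω = 0} = 2 * P {ω | 0 < B s ω ∧ B u ω < 0} := by
  have : IsProbabilityMeasure P := hB.isGaussianProcess.isProbabilityMeasure
  have hms (a b : ℝ) : MeasurableSet {ω | a < B s ω ∧ B u ω < b} :=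
    (measurableSet_lt measurable_const (hm _)).inter (measurableSet_lt (hm _) measurable_const)
  refine le_antisymm ?_ ?_
  -- Upper bound: a zero lies below every level 1/(m+1), so reflection applies at that level,
  -- provided the path starts above it; the sets indexed by `M` exhaust the positive starts. As m
  -- grows the bound tends to the claim because `B u` has no atom at 0.
  · have h0 : P {ω | B u ω = 0} = 0 := measure_eval_eq_zero hB.toIsPreBrownianReal hu
    have hlim : Tendsto (fun m : ℕ ↦ 2 * P {ω | 0 < B s ω ∧ B u ω < 1 / ((m : ℝ) + 1)}) atTop
        (𝓝 (2 * P {ω | 0 < B s ω ∧ B u ω < 0})) := by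
      refine ENNReal.Tendsto.const_mul ?_ (Or.inr (by simp))
      refine tendsto_measure_of_ae_tendsto_indicator_of_isFiniteMeasure atTop (hms _ _)
        (fun n ↦ hms _ _) ?_
      have h0' : ∀ᵐ ω ∂P, B u ω ≠ 0 := measure_eq_zero_iff_ae_notMem.1 h0
      filter_upwards [h0'] with ω hω
      rcases lt_or_gt_of_ne hω with h | h
      · refine Eventually.of_forall fun m ↦ ?_
        have : B u ω < 1 / ((m : ℝ) + 1) := h.trans (by positivity)
        simp only [h, this]
      · filter_upwards [tendsto_inv_succ_atTop.eventually_lt_const h] with m hm'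
        simp only [not_lt.2 h.le, not_lt.2 hm'.le]
    have hU : {ω | 0 < B s ω ∧ ∃ t ∈ Set.Icc s u, B t ω = 0} =
        ⋃ M : ℕ, {ω | 1 / ((M : ℝ) + 1) < B s ω ∧ ∃ t ∈ Set.Icc s u, B t ω = 0} := by
      ext ω
      simp only [Set.mem_ofPred_eq, Set.mem_iUnion]
      constructor
      · rintro ⟨h1, h2⟩
        obtain ⟨M, hM⟩ := exists_nat_one_div_lt h1
        exact ⟨M, hM, h2⟩
      · rintro ⟨M, h1, h2⟩
        exact ⟨lt_trans (by positivity) h1, h2⟩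
    rw [hU, Monotone.measure_iUnion]
    · refine iSup_le fun M ↦ ge_of_tendsto hlim ?_
      filter_upwards [eventually_ge_atTop M] with m hmM
      have hle : 1 / ((m : ℝ) + 1) ≤ 1 / ((M : ℝ) + 1) := by gcongr
      have hpos : 0 < 1 / ((m : ℝ) + 1) := by positivity
      calc P {ω | 1 / ((M : ℝ) + 1) < B s ω ∧ ∃ t ∈ Set.Icc s u, B t ω = 0}
          ≤ P {ω | 1 / ((m : ℝ) + 1) < B s ω ∧ ∃ t ∈ Set.Icc s u, B t ω < 1 / ((m : ℝ) + 1)} := by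
            refine measure_mono ?_
            rintro ω ⟨h1, t, ht, h2⟩
            exact ⟨hle.trans_lt h1, t, ht, h2 ▸ hpos⟩
        _ ≤ 2 * P {ω | 1 / ((m : ℝ) + 1) < B s ω ∧ B u ω < 1 / ((m : ℝ) + 1)} :=
            measure_exists_lt_le hB hm hsu _
        _ ≤ _ := by
            refine mul_le_mul_right (measure_mono ?_) _
            rintro ω ⟨h1, h2⟩
            exact ⟨hpos.trans h1, h2⟩
    · intro M m hmM ω ⟨h1, h2⟩
      refine ⟨lt_of_le_of_lt ?_ h1, h2⟩
      gcongr
  -- Lower bound: a continuous path that is positive at `s` and negative at a later grid point has a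
  -- zero in between. The overshoot vanishes with the mesh, and afterwards `δ` decreases to 0.
  · have hδ : ∀ δ > 0, 2 * P {ω | 0 < B s ω ∧ B u ω < 0 - δ} ≤
        P {ω | 0 < B s ω ∧ ∃ t ∈ Set.Icc s u, B t ω = 0} := by
      intro δ hδ
      have h1 := (ENNReal.Tendsto.const_mul (a := 2) (tendsto_measure_oscillation hB hm hsu hδ)
        (Or.inr (by simp))).const_add (P {ω | 0 < B s ω ∧ ∃ t ∈ Set.Icc s u, B t ω = 0})
      rw [mul_zero, add_zero] at h1
      refine ge_of_tendsto' h1 fun n ↦ ?_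
      have h2 := two_mul_measure_le_exists_grid_lt hB.toIsPreBrownianReal hm
        (monotone_dyadicGrid s u n) 0 δ (2 ^ n) hδ.le
      rw [dyadicGrid_zero, dyadicGrid_last hsu] at h2
      refine h2.trans ?_
      gcongr ?_ + _
      refine measure_mono_ae ?_
      filter_upwards [hB.cont] with ω hω ⟨h3, i, hi, h4⟩
      refine ⟨h3, ?_⟩
      have hmem := dyadicGrid_mem hsu hi
      obtain ⟨t, ht, h5⟩ := intermediate_value_Icc' hmem.1 hω.continuousOn
        (Set.mem_Icc.2 ⟨h4.le, h3.le⟩)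
      exact ⟨t, ⟨ht.1, ht.2.trans hmem.2⟩, h5⟩
    have hU : {ω | 0 < B s ω ∧ B u ω < 0} =
        ⋃ m : ℕ, {ω | 0 < B s ω ∧ B u ω < 0 - 1 / ((m : ℝ) + 1)} := by
      ext ω
      simp only [Set.mem_ofPred_eq, Set.mem_iUnion]
      constructor
      · rintro ⟨h1, h2⟩
        obtain ⟨M, hM⟩ := exists_nat_one_div_lt (neg_pos.2 h2)
        exact ⟨M, h1, by linarith⟩
      · rintro ⟨M, h1, h2⟩
        have : 0 < 1 / ((M : ℝ) + 1) := by positivity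
        exact ⟨h1, by linarith⟩
    rw [hU, Monotone.measure_iUnion, ENNReal.mul_iSup]
    · exact iSup_le fun m ↦ hδ _ (by positivity)
    · intro M m hmM ω ⟨h1, h2⟩
      refine ⟨h1, h2.trans_le ?_⟩
      gcongr

end ZeroProbability

/-! ### Gaussian quadrant probability and the probability of a zero in an interval. -/

section Quadrant

lemma lintegral_Ioi_mul_exp_neg_mul_sq {b : ℝ} (hb : 0 < b) :
    ∫⁻ x in Set.Ioi (0 : ℝ), ENNReal.ofReal (x * Real.exp (-b * x ^ 2)) =
      ENNReal.ofReal (1 / (2 * b)) := by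
  have hd : ∀ x ∈ Set.Ici (0 : ℝ), HasDerivAt (fun x ↦ -(1 / (2 * b)) * Real.exp (-b * x ^ 2))
      (x * Real.exp (-b * x ^ 2)) x := by
    intro x _
    have := (((hasDerivAt_pow 2 x).const_mul (-b)).exp).const_mul (-(1 / (2 * b)))
    convert! this using 1
    field_simp
    norm_num [mul_comm]
  have hlim : Tendsto (fun x : ℝ ↦ -(1 / (2 * b)) * Real.exp (-b * x ^ 2)) atTop (𝓝 0) := by
    have h1 : Tendsto (fun x : ℝ ↦ -b * x ^ 2) atTop atBot :=
      (tendsto_pow_atTop two_ne_zero).const_mul_atTop_of_neg (neg_neg_of_pos hb)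
    simpa using (Real.tendsto_exp_atBot.comp h1).const_mul (-(1 / (2 * b)))
  have hpos : ∀ x ∈ Set.Ioi (0 : ℝ), 0 ≤ x * Real.exp (-b * x ^ 2) :=
    fun x hx ↦ mul_nonneg (le_of_lt hx) (Real.exp_nonneg _)
  have hi := integral_Ioi_of_hasDerivAt_of_nonneg' hd hpos hlim
  have hint := integrableOn_Ioi_deriv_of_nonneg' hd hpos hlim
  rw [← ofReal_integral_eq_lintegral_ofReal hint
    ((ae_restrict_iff' measurableSet_Ioi).2 (ae_of_all _ hpos)), hi]
  simp

lemma lintegral_Ioi_inv_one_add_sq (c : ℝ) :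
    ∫⁻ w in Set.Ioi c, ENNReal.ofReal ((1 + w ^ 2)⁻¹) =
      ENNReal.ofReal (Real.pi / 2 - Real.arctan c) := by
  rw [← integral_Ioi_inv_one_add_sq, ofReal_integral_eq_lintegral_ofReal
    integrable_inv_one_add_sq.integrableOn (ae_of_all _ fun x ↦ by positivity)]

/-- The density of the ratio of two independent centered Gaussian variables, before integration
in the radial variable. -/
lemma gaussianPDF_mul_gaussianReal_Iio {s v : ℝ≥0} (hs : s ≠ 0) (hv : v ≠ 0) {x : ℝ}
    (hx : 0 < x) :
    gaussianPDF 0 s x * gaussianReal 0 v (Set.Iio (-x)) =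
      ∫⁻ w in Set.Ioi (√(s / v)), ENNReal.ofReal (1 / (2 * Real.pi * s)) *
        ENNReal.ofReal (x * Real.exp (-((1 + w ^ 2) / (2 * s)) * x ^ 2)) := by
  have hs' : (0 : ℝ) < s := by positivity
  have hv' : (0 : ℝ) < v := by positivity
  -- The substitution y = -kw rescales the second variable so that the limit √(s/v) does not depend
  -- on `x` and both exponents merge into (1+w²)x²/(2s).
  set k : ℝ := x * √(v / s) with hk
  have hkpos : 0 < k := by positivity
  have hkk : k * √(s / v) = x := by
    rw [hk, mul_assoc, ← Real.sqrt_mul (by positivity), div_mul_div_cancel₀ hs'.ne',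
      div_self hv'.ne', Real.sqrt_one, mul_one]
  have himg : (fun w : ℝ ↦ -k * w) '' Set.Ioi (√(s / v)) = Set.Iio (-x) := by
    ext y
    simp only [Set.mem_image, Set.mem_Ioi, Set.mem_Iio]
    constructor
    · rintro ⟨w, hw, rfl⟩
      have := mul_lt_mul_of_pos_left hw hkpos
      rw [hkk] at this
      linarith
    · intro hy
      refine ⟨-y / k, ?_, by field_simp⟩
      rw [lt_div_iff₀ hkpos, mul_comm, hkk]
      linarith
  have hd : ∀ w ∈ Set.Ioi (√(s / v : ℝ)),
      HasDerivWithinAt (fun w : ℝ ↦ -k * w) (-k) (Set.Ioi (√(s / v))) w := by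
    intro w _
    simpa using ((hasDerivAt_id w).const_mul (-k)).hasDerivWithinAt
  have hinj : Set.InjOn (fun w : ℝ ↦ -k * w) (Set.Ioi (√(s / v))) :=
    fun a _ b _ h ↦ mul_left_cancel₀ (neg_ne_zero.2 hkpos.ne') h
  rw [gaussianReal_apply _ hv, ← himg,
    lintegral_image_eq_lintegral_abs_deriv_mul measurableSet_Ioi hd hinj,
    ← lintegral_const_mul' _ _ (by simp [gaussianPDF])]
  refine lintegral_congr fun w ↦ ?_
  simp only [gaussianPDF]
  rw [← ENNReal.ofReal_mul (by positivity), ← ENNReal.ofReal_mul (gaussianPDFReal_nonneg _ _ _),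
    ← ENNReal.ofReal_mul (by positivity)]
  congr 1
  simp only [gaussianPDFReal, sub_zero, abs_neg, abs_of_pos hkpos]
  have he : Real.exp (-((1 + w ^ 2) / (2 * s)) * x ^ 2) =
      Real.exp (-x ^ 2 / (2 * s)) * Real.exp (-(-k * w) ^ 2 / (2 * v)) := by
    rw [← Real.exp_add]
    congr 1
    have : (-k * w) ^ 2 = x ^ 2 * (v / s) * w ^ 2 := by
      rw [neg_mul, neg_sq, mul_pow, hk, mul_pow, Real.sq_sqrt (by positivity)]
    rw [this]
    field_simp
    ring
  rw [he]
  have hc : (√(2 * Real.pi * s))⁻¹ * (k * (√(2 * Real.pi * v))⁻¹) = 1 / (2 * Real.pi * s) * x := by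
    rw [hk, Real.sqrt_div hv'.le, Real.sqrt_mul (by positivity), Real.sqrt_mul (by positivity) (v : ℝ)]
    have h1 : √(2 * Real.pi) ^ 2 = 2 * Real.pi := Real.sq_sqrt (by positivity)
    have h2 : √(s : ℝ) ^ 2 = s := Real.sq_sqrt hs'.le
    have h3 : 0 < √(v : ℝ) := Real.sqrt_pos.2 hv'
    have h4 : 0 < √(s : ℝ) := Real.sqrt_pos.2 hs'
    have h5 : 0 < √(2 * Real.pi) := by positivity
    have h6 : 1 / (2 * Real.pi * s) = 1 / (√(2 * Real.pi) ^ 2 * √(s : ℝ) ^ 2) := by rw [h1, h2]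
    rw [h6]
    field_simp
  linear_combination (Real.exp (-x ^ 2 / (2 * s)) * Real.exp (-(-k * w) ^ 2 / (2 * v))) * hc

/-- Tonelli lets the radial variable `x` be integrated before the slope `w`. What remains is a
Cauchy density in `w`, whose tail is an arctangent. -/
lemma lintegral_Ioi_gaussianPDF_mul {s v : ℝ≥0} (hs : s ≠ 0) (hv : v ≠ 0) :
    ∫⁻ x in Set.Ioi 0, gaussianPDF 0 s x * gaussianReal 0 v (Set.Iio (-x)) =
      ENNReal.ofReal (1 / (2 * Real.pi)) *
        ENNReal.ofReal (Real.pi / 2 - Real.arctan √(s / v)) := by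
  have hs' : (0 : ℝ) < s := by positivity
  rw [setLIntegral_congr_fun measurableSet_Ioi
    (fun x hx ↦ gaussianPDF_mul_gaussianReal_Iio hs hv hx), lintegral_lintegral_swap]
  · have h1 : ∀ w : ℝ, ∫⁻ x in Set.Ioi (0 : ℝ), ENNReal.ofReal (1 / (2 * Real.pi * s)) *
        ENNReal.ofReal (x * Real.exp (-((1 + w ^ 2) / (2 * s)) * x ^ 2)) =
        ENNReal.ofReal (1 / (2 * Real.pi)) * ENNReal.ofReal ((1 + w ^ 2)⁻¹) := by
      intro w
      rw [lintegral_const_mul' _ _ ENNReal.ofReal_ne_top, lintegral_Ioi_mul_exp_neg_mul_sq (by positivity),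
        ← ENNReal.ofReal_mul (by positivity), ← ENNReal.ofReal_mul (by positivity)]
      congr 1
      field_simp
    simp_rw [h1]
    rw [lintegral_const_mul' _ _ (by simp), lintegral_Ioi_inv_one_add_sq]
  · fun_prop

variable {Ω : Type*} [MeasurableSpace Ω] {P : Measure Ω} {B : ℝ≥0 → Ω → ℝ}

/-- The quadrant probability of a Brownian motion at two times. -/
lemma measure_pos_neg (hB : IsPreBrownianReal B P) {s u : ℝ≥0} (hs : s ≠ 0) (hsu : s < u) :
    P {ω | 0 < B s ω ∧ B u ω < 0} = ENNReal.ofReal (1 / (2 * Real.pi)) *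
        ENNReal.ofReal (Real.pi / 2 - Real.arctan √(s / (u - s))) := by
  have : IsProbabilityMeasure P := hB.isGaussianProcess.isProbabilityMeasure
  have hv : u - s ≠ 0 := (tsub_pos_of_lt hsu).ne'
  have hind : B s ⟂ᵢ[P] (B u - B s) :=
    hB.hasIndepIncrements.indepFun_eval_sub zero_le hsu.le hB.eval_zero_ae_eq_zero
  have hlaw : P.map (B u - B s) = gaussianReal 0 (u - s) := by
    rw [(hB.hasLaw_sub u s).map_eq]
    congr 1
    ext
    rw [coe_nndist, Real.dist_eq, NNReal.coe_sub hsu.le, abs_of_nonneg]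
    · rfl
    · exact sub_nonneg.2 hsu.le
  have hprod := (indepFun_iff_map_prod_eq_prod_map_map (hB.aemeasurable s)
    ((hB.aemeasurable u).sub (hB.aemeasurable s))).1 hind
  rw [(hB.hasLaw_eval s).map_eq, hlaw] at hprod
  set S : Set (ℝ × ℝ) := {p | 0 < p.1 ∧ p.1 + p.2 < 0} with hS
  have hSm : MeasurableSet S := (measurableSet_lt measurable_const measurable_fst).inter
    (measurableSet_lt (measurable_fst.add measurable_snd) measurable_const)
  have h1 : P {ω | 0 < B s ω ∧ B u ω < 0} = P.map (fun ω ↦ (B s ω, (B u - B s) ω)) S := by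
    rw [Measure.map_apply_of_aemeasurable ((hB.aemeasurable s).prodMk
      ((hB.aemeasurable u).sub (hB.aemeasurable s))) hSm]
    congr 1
    ext ω
    simp [hS]
  have h2 : ∀ x : ℝ, gaussianReal 0 (u - s) (Prod.mk x ⁻¹' S) =
      (Set.Ioi 0).indicator (fun x ↦ gaussianReal 0 (u - s) (Set.Iio (-x))) x := by
    intro x
    by_cases hx : 0 < x
    · rw [Set.indicator_of_mem (Set.mem_Ioi.2 hx)]
      congr 1
      ext y
      simp [hS, hx, lt_neg_iff_add_neg']
    · rw [Set.indicator_of_notMem (by simpa using hx)]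
      have : Prod.mk x ⁻¹' S = ∅ := by ext y; simp [hS, hx]
      rw [this, measure_empty]
  have hmeas : Measurable fun x : ℝ ↦ gaussianReal 0 (u - s) (Set.Iio (-x)) := by
    refine Antitone.measurable fun a b hab ↦ measure_mono ?_
    exact Set.Iio_subset_Iio (neg_le_neg hab)
  rw [h1, hprod, Measure.prod_apply hSm]
  simp_rw [h2]
  rw [lintegral_indicator measurableSet_Ioi, gaussianReal_of_var_ne_zero _ hs,
    setLIntegral_withDensity_eq_setLIntegral_mul _ (measurable_gaussianPDF _ _) hmeas
      measurableSet_Ioi]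
  have := lintegral_Ioi_gaussianPDF_mul hs hv
  simp only [Pi.mul_apply]
  rw [this, NNReal.coe_sub hsu.le]

/-- The probability that a Brownian motion has a zero between two times. -/
lemma measure_exists_zero (hB : IsBrownianReal B P) (hm : ∀ t, Measurable (B t))
    {s u : ℝ≥0} (hs : s ≠ 0) (hsu : s < u) :
    P {ω | ∃ t ∈ Set.Icc s u, B t ω = 0} =
      ENNReal.ofReal (1 - 2 / Real.pi * Real.arctan √(s / (u - s))) := by
  have hu : u ≠ 0 := (pos_of_gt hsu).ne'
  have h1 := measure_pos_exists_zero hB hm hsu.le hu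
  have h2 := measure_pos_exists_zero hB.neg (fun t ↦ (hm t).neg) hsu.le hu
  rw [measure_pos_neg hB.toIsPreBrownianReal hs hsu] at h1
  rw [measure_pos_neg hB.neg.toIsPreBrownianReal hs hsu] at h2
  simp only [Pi.neg_apply, Left.neg_pos_iff, neg_eq_zero] at h2
  have h0 : ∀ᵐ ω ∂P, B s ω ≠ 0 :=
    measure_eq_zero_iff_ae_notMem.1 (measure_eval_eq_zero hB.toIsPreBrownianReal hs)
  -- Split according to the sign of `B s`, which is almost surely nonzero. The negative half is the
  -- positive half for the Brownian motion -B.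
  have h3 : P {ω | ∃ t ∈ Set.Icc s u, B t ω = 0} =
      P {ω | 0 < B s ω ∧ ∃ t ∈ Set.Icc s u, B t ω = 0} +
      P {ω | B s ω < 0 ∧ ∃ t ∈ Set.Icc s u, B t ω = 0} := by
    rw [← measure_inter_add_sdiff _ (measurableSet_lt measurable_const (hm s) :
      MeasurableSet {ω | 0 < B s ω})]
    congr 1
    · congr 1
      ext ω
      simp only [Set.mem_inter_iff, Set.mem_ofPred_eq, and_comm]
    · refine measure_congr ?_
      filter_upwards [h0] with ω hω
      refine propext ⟨fun h ↦ ⟨lt_of_le_of_ne (not_lt.1 h.2) hω, h.1⟩,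
        fun h ↦ ⟨h.2, not_lt.2 h.1.le⟩⟩
  rw [h3, h1, h2, ← two_mul, ← ENNReal.ofReal_mul (by positivity)]
  rw [show (2 : ENNReal) = ENNReal.ofReal 2 by simp, ← ENNReal.ofReal_mul (by positivity),
    ← ENNReal.ofReal_mul (by positivity)]
  congr 1
  field_simp

end Quadrant

/-! ### A measurable functional for the last zero of a path. -/

section LastZeroFunctional

/-- The last zero of the path `w` on `[0, u]`, as a jointly measurable function of `u` and `w`.
It coincides with the last zero for continuous paths started at `0`, see
`lastZeroBefore_eq_sSup`. -/
noncomputable def lastZeroBefore (u : ℝ≥0) (w : ℝ≥0 → ℝ) : ENNReal :=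
  open scoped Classical in
  ⨆ n : ℕ, if TopologicalSpace.denseSeq ℝ≥0 n < u ∧
      ∀ m : ℕ, ∃ k : ℕ, TopologicalSpace.denseSeq ℝ≥0 n ≤ TopologicalSpace.denseSeq ℝ≥0 k ∧
        TopologicalSpace.denseSeq ℝ≥0 k ≤ u ∧
        |w (TopologicalSpace.denseSeq ℝ≥0 k)| < 1 / ((m : ℝ) + 1)
    then (TopologicalSpace.denseSeq ℝ≥0 n : ENNReal) else 0

lemma measurable_lastZeroBefore :
    Measurable fun p : ℝ≥0 × (ℝ≥0 → ℝ) ↦ lastZeroBefore p.1 p.2 := by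
  refine Measurable.iSup fun n ↦ Measurable.ite ?_ measurable_const measurable_const
  have h : {p : ℝ≥0 × (ℝ≥0 → ℝ) | TopologicalSpace.denseSeq ℝ≥0 n < p.1 ∧
      ∀ m : ℕ, ∃ k : ℕ, TopologicalSpace.denseSeq ℝ≥0 n ≤ TopologicalSpace.denseSeq ℝ≥0 k ∧
        TopologicalSpace.denseSeq ℝ≥0 k ≤ p.1 ∧
        |p.2 (TopologicalSpace.denseSeq ℝ≥0 k)| < 1 / ((m : ℝ) + 1)} =
      {p | TopologicalSpace.denseSeq ℝ≥0 n < p.1} ∩ ⋂ m : ℕ, ⋃ k : ℕ,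
        ({_p | TopologicalSpace.denseSeq ℝ≥0 n ≤ TopologicalSpace.denseSeq ℝ≥0 k} ∩
        ({p | TopologicalSpace.denseSeq ℝ≥0 k ≤ p.1} ∩
        {p | |p.2 (TopologicalSpace.denseSeq ℝ≥0 k)| < 1 / ((m : ℝ) + 1)})) := by
    ext p; simp
  rw [h]
  refine (measurableSet_lt measurable_const measurable_fst).inter
    (.iInter fun m ↦ .iUnion fun k ↦ (MeasurableSet.const _).inter
    ((measurableSet_le measurable_const measurable_fst).inter
      (measurableSet_lt ?_ measurable_const)))
  exact ((measurable_pi_apply _).comp measurable_snd).abs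

/-- On a compact interval |w| attains its minimum, so arbitrarily small values along a countable
dense set force a zero. Strictness of `q < u` makes the interval the closure of its interior, so a
zero at an endpoint is also approached by dense times inside. -/
lemma exists_zero_iff_denseSeq {w : ℝ≥0 → ℝ} (hw : Continuous w) {q u : ℝ≥0} (hq : q < u) :
    (∃ t ∈ Set.Icc q u, w t = 0) ↔ ∀ m : ℕ, ∃ k : ℕ, q ≤ TopologicalSpace.denseSeq ℝ≥0 k ∧
        TopologicalSpace.denseSeq ℝ≥0 k ≤ u ∧
        |w (TopologicalSpace.denseSeq ℝ≥0 k)| < 1 / ((m : ℝ) + 1) := by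
  constructor
  · rintro ⟨t, ht, h0⟩ m
    have hopen : IsOpen {v | |w v| < 1 / ((m : ℝ) + 1)} := isOpen_lt hw.abs continuous_const
    have htm : t ∈ {v | |w v| < 1 / ((m : ℝ) + 1)} := by
      simp only [Set.mem_ofPred_eq, h0, abs_zero]; positivity
    have hcl : t ∈ closure (Set.Ioo q u) := by rwa [closure_Ioo hq.ne]
    obtain ⟨v, hv⟩ := mem_closure_iff.1 hcl _ hopen htm
    obtain ⟨y, hy, k, rfl⟩ := (TopologicalSpace.denseRange_denseSeq ℝ≥0).exists_mem_open
      (hopen.inter isOpen_Ioo) ⟨v, hv⟩ |>.elim fun k hk ↦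
        (⟨_, hk, k, rfl⟩ : ∃ y ∈ _ ∩ Set.Ioo q u, ∃ k, TopologicalSpace.denseSeq ℝ≥0 k = y)
    exact ⟨k, hy.2.1.le, hy.2.2.le, hy.1⟩
  · intro h
    obtain ⟨t, ht, hmin⟩ := (isCompact_Icc (a := q) (b := u)).exists_isMinOn
      (Set.nonempty_Icc.2 hq.le) hw.abs.continuousOn
    refine ⟨t, ht, abs_eq_zero.1 (le_antisymm ?_ (abs_nonneg _))⟩
    refine ge_of_tendsto' tendsto_inv_succ_atTop fun m ↦ ?_
    obtain ⟨k, h1, h2, h3⟩ := h m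
    exact (hmin (Set.mem_Icc.2 ⟨h1, h2⟩)).trans h3.le

/-- The zero at time 0 makes the closed zero set nonempty, so its supremum is a zero. Every dense
time before this zero then enters the countable supremum, and no later one does. -/
lemma lastZeroBefore_eq_sSup {w : ℝ≥0 → ℝ} (hw : Continuous w) (hw0 : w 0 = 0) (u : ℝ≥0) :
    lastZeroBefore u w = ((sSup {t | t ≤ u ∧ w t = 0} : ℝ≥0) : ENNReal) := by
  have hbdd : BddAbove {t | t ≤ u ∧ w t = 0} := ⟨u, fun t ht ↦ ht.1⟩
  have hne : {t | t ≤ u ∧ w t = 0}.Nonempty := ⟨0, zero_le, hw0⟩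
  have hclosed : IsClosed {t | t ≤ u ∧ w t = 0} :=
    (isClosed_le continuous_id continuous_const).inter (isClosed_eq hw continuous_const)
  have hmem := hclosed.csSup_mem hne hbdd
  refine le_antisymm (iSup_le fun n ↦ ?_) (le_of_forall_lt fun y hy ↦ ?_)
  · split_ifs with h
    · obtain ⟨t, ht, h0⟩ := (exists_zero_iff_denseSeq hw h.1).2 h.2
      exact ENNReal.coe_le_coe.2 (ht.1.trans (le_csSup hbdd ⟨ht.2, h0⟩))
    · exact zero_le
  · obtain ⟨y, rfl⟩ := ENNReal.lt_iff_exists_coe.1 hy |>.imp fun _ h ↦ h.1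
    have hy' : y < sSup {t | t ≤ u ∧ w t = 0} := ENNReal.coe_lt_coe.1 hy
    obtain ⟨_, ⟨n, rfl⟩, h1, h2⟩ :=
      (TopologicalSpace.denseRange_denseSeq ℝ≥0).exists_between hy'
    refine lt_of_lt_of_le (ENNReal.coe_lt_coe.2 h1) (le_iSup_of_le n ?_)
    have hlt := h2.trans_le hmem.1
    rw [if_pos ⟨hlt, (exists_zero_iff_denseSeq hw hlt).1 ⟨_, ⟨h2.le, hmem.1⟩, hmem.2⟩⟩]

end LastZeroFunctional

/-! ### Lévy's arcsine law. -/

section Arcsine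

/-- The arcsine law on `[0, u]`. -/
noncomputable def arcsineMeasure (u : ℝ) : Measure ℝ :=
  (volume.restrict (Set.Ioo 0 u)).withDensity
    fun y ↦ ENNReal.ofReal (1 / (Real.pi * √(y * (u - y))))

/-- The primitive is (2/π) arcsin √(y/u). Its continuity up to the endpoints and the sign of its
derivative yield integrability despite the endpoint singularities. -/
lemma lintegral_Ioo_arcsine {u x : ℝ} (hx : 0 ≤ x) (hxu : x ≤ u) (hu : 0 < u) :
    ∫⁻ y in Set.Ioo x u, ENNReal.ofReal (1 / (Real.pi * √(y * (u - y)))) =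
      ENNReal.ofReal (1 - 2 / Real.pi * Real.arcsin √(x / u)) := by
  have hcont : ContinuousOn (fun y ↦ 2 / Real.pi * Real.arcsin √(y / u)) (Set.Icc x u) := by
    fun_prop
  have hd : ∀ y ∈ Set.Ioo x u, HasDerivAt (fun y ↦ 2 / Real.pi * Real.arcsin √(y / u))
      (1 / (Real.pi * √(y * (u - y)))) y := by
    intro y hy
    have hy0 : 0 < y := hx.trans_lt hy.1
    have hyu : 0 < u - y := sub_pos.2 hy.2
    have h1 : √(y / u) < 1 := by
      rw [Real.sqrt_lt' one_pos, one_pow, div_lt_one hu]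
      exact hy.2
    have h0 : 0 < √(y / u) := by positivity
    have h2 := ((Real.hasDerivAt_arcsin (by linarith) h1.ne).comp y
      (((hasDerivAt_id y).div_const u).sqrt (div_pos hy0 hu).ne')).const_mul (2 / Real.pi)
    convert! h2 using 1
    simp only [id]
    rw [Real.sq_sqrt (by positivity), show 1 - y / u = (u - y) / u by field_simp,
      Real.sqrt_mul hy0.le, Real.sqrt_div hyu.le, Real.sqrt_div hy0.le]
    have h3 := Real.sq_sqrt hu.le
    have h4 : 0 < √u := Real.sqrt_pos.2 hu
    have h5 : 0 < √y := Real.sqrt_pos.2 hy0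
    have h6 : 0 < √(u - y) := Real.sqrt_pos.2 hyu
    field_simp
    rw [h3]
  have hpos : ∀ y ∈ Set.Ioo x u, 0 ≤ 1 / (Real.pi * √(y * (u - y))) := fun y _ ↦ by positivity
  have hint := intervalIntegral.integrableOn_deriv_of_nonneg hcont hd hpos
  have hval := intervalIntegral.integral_eq_sub_of_hasDerivAt_of_le hxu hcont hd
    ((intervalIntegrable_iff_integrableOn_Ioc_of_le hxu).2 hint)
  rw [restrict_Ioo_eq_restrict_Ioc, ← ofReal_integral_eq_lintegral_ofReal hint
    (ae_of_all _ fun y ↦ by positivity), ← intervalIntegral.integral_of_le hxu, hval,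
    div_self hu.ne', Real.sqrt_one, Real.arcsin_one]
  congr 2
  field_simp

/-- Converts the angle in the zero probability into the arcsine of the distribution function. -/
lemma arctan_sqrt_div_sub {u x : ℝ} (hx : 0 ≤ x) (hxu : x < u) :
    Real.arctan √(x / (u - x)) = Real.arcsin √(x / u) := by
  have h1 : 0 < u - x := sub_pos.2 hxu
  rw [Real.arctan_eq_arcsin, Real.sq_sqrt (by positivity), ← Real.sqrt_div (by positivity)]
  congr 2
  have hu : u ≠ 0 := (hx.trans_lt hxu).ne'
  field_simp
  ring

lemma arcsineMeasure_Ici {u : ℝ} (hu : 0 < u) (x : ℝ) :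
    arcsineMeasure u (Set.Ici x) =
      if x < u then ENNReal.ofReal (1 - 2 / Real.pi * Real.arcsin √(max x 0 / u)) else 0 := by
  rw [arcsineMeasure, withDensity_apply _ measurableSet_Ici,
    Measure.restrict_restrict measurableSet_Ici]
  split_ifs with h
  · rw [← lintegral_Ioo_arcsine (le_max_right _ _) (max_le h.le hu.le) hu]
    refine setLIntegral_congr ?_
    have h1 : Set.Ici x ∩ Set.Ioo 0 u ⊆ Set.Icc (max x 0) u :=
      fun y hy ↦ ⟨max_le hy.1 hy.2.1.le, hy.2.2.le⟩
    have h2 : Set.Ioo (max x 0) u ⊆ Set.Ici x ∩ Set.Ioo 0 u := fun y hy ↦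
      ⟨(le_max_left _ _).trans hy.1.le, (le_max_right _ _).trans_lt hy.1, hy.2⟩
    exact (h1.eventuallyLE.trans_eq Ioo_ae_eq_Icc.symm).antisymm h2.eventuallyLE
  · have : Set.Ici x ∩ Set.Ioo 0 u = ∅ := by
      ext y
      simp only [Set.mem_inter_iff, Set.mem_Ici, Set.mem_Ioo, Set.mem_empty_iff_false, iff_false]
      rintro ⟨h1, -, h2⟩
      exact h (h1.trans_lt h2)
    simp [this]

variable {Ω : Type*} [MeasurableSpace Ω] {P : Measure Ω} {B : ℝ≥0 → Ω → ℝ}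

/-- **Lévy's arcsine law** for the last zero of Brownian motion on `[0, u]`. -/
theorem map_lastZeroBefore (hB : IsBrownianReal B P) (hm : ∀ t, Measurable (B t))
    {u : ℝ≥0} (hu : u ≠ 0) :
    P.map (fun ω ↦ (lastZeroBefore u fun t ↦ B t ω).toReal) = arcsineMeasure u := by
  have : IsProbabilityMeasure P := hB.isGaussianProcess.isProbabilityMeasure
  have hu' : (0 : ℝ) < u := by positivity
  have hmeas : Measurable (fun ω ↦ (lastZeroBefore u fun t ↦ B t ω).toReal) :=
    (measurable_lastZeroBefore.comp (measurable_const.prodMk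
      (measurable_pi_lambda _ fun t ↦ hm t))).ennreal_toReal
  have := Measure.isProbabilityMeasure_map (μ := P) hmeas.aemeasurable
  refine Measure.ext_of_Ici _ _ fun x ↦ ?_
  rw [arcsineMeasure_Ici hu', Measure.map_apply hmeas measurableSet_Ici]
  rcases le_or_gt x 0 with hx | hx
  · rw [max_eq_right hx, if_pos (hx.trans_lt hu')]
    have : (fun ω ↦ (lastZeroBefore u fun t ↦ B t ω).toReal) ⁻¹' Set.Ici x = Set.univ := by
      ext ω
      simpa using hx.trans ENNReal.toReal_nonneg
    rw [this]
    simp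
  · rw [max_eq_left hx.le]
    lift x to ℝ≥0 using hx.le
    have hx' : x ≠ 0 := by rintro rfl; simp at hx
    have hset : P ((fun ω ↦ (lastZeroBefore u fun t ↦ B t ω).toReal) ⁻¹' Set.Ici (x : ℝ)) =
        P {ω | ∃ t ∈ Set.Icc x u, B t ω = 0} := by
      refine measure_congr ?_
      filter_upwards [hB.cont, hB.eval_zero_ae_eq_zero] with ω h1 h2
      refine propext ?_
      change (x : ℝ) ≤ (lastZeroBefore u fun t ↦ B t ω).toReal ↔ ∃ t ∈ Set.Icc x u, B t ω = 0
      rw [lastZeroBefore_eq_sSup h1 h2, ENNReal.coe_toReal, NNReal.coe_le_coe]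
      have hbdd : BddAbove {t | t ≤ u ∧ B t ω = 0} := ⟨u, fun t ht ↦ ht.1⟩
      have hclosed : IsClosed {t | t ≤ u ∧ B t ω = 0} :=
        (isClosed_le continuous_id continuous_const).inter (isClosed_eq h1 continuous_const)
      have hmem := hclosed.csSup_mem ⟨0, zero_le, h2⟩ hbdd
      exact ⟨fun h ↦ ⟨_, ⟨h, hmem.1⟩, hmem.2⟩,
        fun ⟨t, ht, h0⟩ ↦ ht.1.trans (le_csSup hbdd ⟨ht.2, h0⟩)⟩
    rw [hset]
    split_ifs with h
    · rw [measure_exists_zero hB hm hx' (NNReal.coe_lt_coe.1 h),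
        arctan_sqrt_div_sub x.coe_nonneg h]
    -- Here `u ≤ x`, so a zero in [x,u] can only occur at `u` itself, which is a null event.
    · refine measure_mono_null ?_ (measure_eval_eq_zero hB.toIsPreBrownianReal hu)
      rintro ω ⟨t, ht, h0⟩
      have hux : u ≤ x := NNReal.coe_le_coe.1 (not_lt.1 h)
      have : t = u := le_antisymm ht.2 (hux.trans ht.1)
      exact this ▸ h0

/-- Expectations of functions of the last zero of a Brownian motion started at time `c`. -/
lemma lintegral_add_lastZeroBefore (hB : IsBrownianReal B P) (hm : ∀ t, Measurable (B t))
    {u : ℝ≥0} (hu : u ≠ 0) {f : ℝ → ENNReal} (hf : Measurable f) (c : ℝ) :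
    ∫⁻ ω, f (c + (lastZeroBefore u fun t ↦ B t ω).toReal) ∂P =
      ∫⁻ y in Set.Ioo c (c + u),
        ENNReal.ofReal (1 / (Real.pi * √((y - c) * (c + u - y)))) * f y := by
  have hmeas : Measurable (fun ω ↦ (lastZeroBefore u fun t ↦ B t ω).toReal) :=
    (measurable_lastZeroBefore.comp (measurable_const.prodMk
      (measurable_pi_lambda _ fun t ↦ hm t))).ennreal_toReal
  have h1 : ∫⁻ ω, f (c + (lastZeroBefore u fun t ↦ B t ω).toReal) ∂P =
      ∫⁻ z, f (c + z) ∂(arcsineMeasure u) := by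
    rw [← map_lastZeroBefore hB hm hu, lintegral_map (by fun_prop) hmeas]
  rw [h1, arcsineMeasure, lintegral_withDensity_eq_lintegral_mul _ (by fun_prop) (by fun_prop),
    ← lintegral_indicator measurableSet_Ioo, ← lintegral_indicator measurableSet_Ioo,
    ← lintegral_add_left_eq_self ((Set.Ioo c (c + u)).indicator _) c]
  refine lintegral_congr fun z ↦ ?_
  by_cases hz : z ∈ Set.Ioo (0 : ℝ) u
  · have hz' : c + z ∈ Set.Ioo c (c + u) := ⟨by linarith [hz.1], by linarith [hz.2]⟩
    rw [Set.indicator_of_mem hz, Set.indicator_of_mem hz']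
    simp only [Pi.mul_apply]
    ring_nf
  · have hz' : c + z ∉ Set.Ioo c (c + u) := fun h ↦ hz ⟨by linarith [h.1], by linarith [h.2]⟩
    rw [Set.indicator_of_notMem hz, Set.indicator_of_notMem hz']

end Arcsine

/-! ### The law of the last reset. -/

section LastReset

/-- The last jump before time `1` of a counting path, as a measurable function of the path. It
coincides with the last jump time for monotone paths, see `lastReset_eq_sInf`. -/
noncomputable def lastReset (n : ℝ≥0 → ℕ) : ℝ≥0 :=
  (⨅ k : ℕ, if n 1 ≤ n (TopologicalSpace.denseSeq ℝ≥0 k)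
    then (TopologicalSpace.denseSeq ℝ≥0 k : ENNReal) else ⊤).toNNReal

lemma measurable_lastReset : Measurable lastReset := by
  refine (Measurable.iInf fun k ↦ Measurable.ite ?_ measurable_const measurable_const
    : Measurable _).ennreal_toNNReal
  exact measurableSet_le (measurable_pi_apply _) (measurable_pi_apply _)

lemma lastReset_eq_sInf {n : ℝ≥0 → ℕ} (hn : Monotone n) :
    lastReset n = sInf {t : ℝ≥0 | n 1 ≤ n t} := by
  have hne : {t : ℝ≥0 | n 1 ≤ n t}.Nonempty := ⟨1, le_refl (n 1)⟩
  suffices h : (⨅ k : ℕ, if n 1 ≤ n (TopologicalSpace.denseSeq ℝ≥0 k)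
      then (TopologicalSpace.denseSeq ℝ≥0 k : ENNReal) else ⊤) =
      ((sInf {t : ℝ≥0 | n 1 ≤ n t} : ℝ≥0) : ENNReal) by
    rw [lastReset, h, ENNReal.toNNReal_coe]
  refine le_antisymm (le_of_forall_gt fun y hy ↦ ?_) (le_iInf fun k ↦ ?_)
  · obtain ⟨z, hz, hzy⟩ := ENNReal.lt_iff_exists_nnreal_btwn.1 hy
    obtain ⟨t, ht, htz⟩ := exists_lt_of_csInf_lt hne (ENNReal.coe_lt_coe.1 hz)
    obtain ⟨_, ⟨k, rfl⟩, h1, h2⟩ :=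
      (TopologicalSpace.denseRange_denseSeq ℝ≥0).exists_between htz
    refine lt_of_le_of_lt (iInf_le_of_le k ?_) ((ENNReal.coe_lt_coe.2 h2).trans hzy)
    rw [if_pos (le_trans ht (hn h1.le))]
  · split_ifs with h
    · exact ENNReal.coe_le_coe.2 (csInf_le (OrderBot.bddBelow _) h)
    · exact le_top

/-- A right-continuous path with discrete values is constant just after each time. Times with full
count lie arbitrarily close to the right of the infimum, so the infimum has full count as well. -/
lemma eval_lastReset {n : ℝ≥0 → ℕ} (hn : Monotone n)
    (hc : ∀ t : ℝ≥0, ContinuousWithinAt n (Set.Ici t) t) : n 1 ≤ n (lastReset n) := by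
  rw [lastReset_eq_sInf hn]
  set T := sInf {t : ℝ≥0 | n 1 ≤ n t} with hT
  have h1 : ∀ᶠ s in 𝓝[≥] T, n s = n T :=
    (hc T).eventually ((isOpen_discrete {n T}).mem_nhds rfl)
  obtain ⟨b, hb, hsub⟩ := (mem_nhdsGE_iff_exists_Ico_subset' (lt_add_one T)).1 h1
  obtain ⟨t, ht, htb⟩ := exists_lt_of_csInf_lt (s := {t : ℝ≥0 | n 1 ≤ n t}) ⟨1, le_refl (n 1)⟩ hb
  have h2 : n t = n T := hsub ⟨csInf_le (OrderBot.bddBelow _) ht, htb⟩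
  exact h2 ▸ ht

lemma lastReset_le_one {n : ℝ≥0 → ℕ} (hn : Monotone n) : lastReset n ≤ 1 := by
  rw [lastReset_eq_sInf hn]
  exact csInf_le (OrderBot.bddBelow _) (le_refl (n 1))

/-- Reduces the distribution function of the last reset to the probability of no jump in (t,1]. -/
lemma lastReset_le_iff {n : ℝ≥0 → ℕ} (hn : Monotone n)
    (hc : ∀ t : ℝ≥0, ContinuousWithinAt n (Set.Ici t) t) (t : ℝ≥0) :
    lastReset n ≤ t ↔ n 1 ≤ n t := by
  refine ⟨fun h ↦ (eval_lastReset hn hc).trans (hn h), fun h ↦ ?_⟩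
  rw [lastReset_eq_sInf hn]
  exact csInf_le (OrderBot.bddBelow _) h

variable {Ω : Type*} [MeasurableSpace Ω] {P : Measure Ω} {N : ℝ≥0 → Ω → ℕ} {r : ℝ≥0}

lemma IsPoissonProcess.isProbabilityMeasure (hN : IsPoissonProcess N r P) :
    IsProbabilityMeasure P := (hN.hasLaw_increment 0 0).isProbabilityMeasure

lemma IsPoissonProcess.measurable_path (hN : IsPoissonProcess N r P) :
    Measurable fun ω t ↦ N t ω := measurable_pi_lambda _ hN.measurable

lemma IsPoissonProcess.measure_lastReset_le (hN : IsPoissonProcess N r P) {t : ℝ≥0}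
    (ht : t ≤ 1) :
    P {ω | lastReset (fun t ↦ N t ω) ≤ t} = ENNReal.ofReal (Real.exp (-(r * (1 - t)))) := by
  -- Truncated subtraction is harmless here: the difference is 0 exactly when `N 1 ω ≤ N t ω`.
  have h1 : P {ω | lastReset (fun t ↦ N t ω) ≤ t} = P {ω | N (t + (1 - t)) ω - N t ω ∈ ({0} : Set ℕ)} := by
    refine measure_congr ?_
    filter_upwards [hN.mono, hN.rightCont] with ω h1 h2
    refine propext ?_
    change lastReset (fun t ↦ N t ω) ≤ t ↔ N (t + (1 - t)) ω - N t ω ∈ ({0} : Set ℕ)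
    rw [lastReset_le_iff h1 h2]
    simp [add_tsub_cancel_of_le ht, Nat.sub_eq_zero_iff_le]
  have h2 := hN.hasLaw_increment t (1 - t)
  rw [h1, h2.measure_eq (p := fun x ↦ x ∈ ({0} : Set ℕ)) (measurableSet_singleton 0)]
  have h3 := poissonMeasure_singleton (r * (1 - t)) 0
  simp only [Set.ofPred_mem_eq]
  rw [h3]
  simp [NNReal.coe_sub ht]

/-- The law of the last reset before time `1`. -/
noncomputable def lastResetMeasure (r : ℝ) : Measure ℝ :=
  ENNReal.ofReal (Real.exp (-r)) • Measure.dirac 0 +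
    (volume.restrict (Set.Ioo 0 1)).withDensity
      fun c ↦ ENNReal.ofReal (r * Real.exp (-(r * (1 - c))))

lemma lintegral_Ioo_exp {r t : ℝ} (hr : 0 ≤ r) (ht : 0 ≤ t) :
    ∫⁻ c in Set.Ioo 0 t, ENNReal.ofReal (r * Real.exp (-(r * (1 - c)))) =
      ENNReal.ofReal (Real.exp (-(r * (1 - t))) - Real.exp (-r)) := by
  have hd : ∀ c : ℝ, HasDerivAt (fun c ↦ Real.exp (-(r * (1 - c))))
      (r * Real.exp (-(r * (1 - c)))) c := by
    intro c
    have := ((((hasDerivAt_id c).const_sub 1).const_mul r).neg).exp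
    convert! this using 1
    simp [mul_comm]
  have hcont : Continuous fun c : ℝ ↦ r * Real.exp (-(r * (1 - c))) := by fun_prop
  have hval := intervalIntegral.integral_eq_sub_of_hasDerivAt (a := 0) (b := t)
    (fun c _ ↦ hd c) (hcont.intervalIntegrable _ _)
  rw [restrict_Ioo_eq_restrict_Ioc, ← ofReal_integral_eq_lintegral_ofReal
    (hcont.integrableOn_Ioc) (ae_of_all _ fun y ↦ by positivity),
    ← intervalIntegral.integral_of_le ht, hval]
  simp

lemma lastResetMeasure_Iic {r : ℝ} (hr : 0 ≤ r) (t : ℝ) :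
    lastResetMeasure r (Set.Iic t) =
      if 0 ≤ t then ENNReal.ofReal (Real.exp (-(r * (1 - min t 1)))) else 0 := by
  rw [lastResetMeasure, Measure.add_apply, Measure.smul_apply, smul_eq_mul,
    withDensity_apply _ measurableSet_Iic, Measure.restrict_restrict measurableSet_Iic,
    Measure.dirac_apply' _ measurableSet_Iic]
  split_ifs with h
  · have h1 : ∫⁻ c in Set.Iic t ∩ Set.Ioo 0 1, ENNReal.ofReal (r * Real.exp (-(r * (1 - c)))) =
        ∫⁻ c in Set.Ioo 0 (min t 1), ENNReal.ofReal (r * Real.exp (-(r * (1 - c)))) := by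
      refine setLIntegral_congr ?_
      have h1 : Set.Iic t ∩ Set.Ioo 0 1 ⊆ Set.Icc 0 (min t 1) :=
        fun y hy ↦ ⟨hy.2.1.le, le_min hy.1 hy.2.2.le⟩
      have h2 : Set.Ioo 0 (min t 1) ⊆ Set.Iic t ∩ Set.Ioo 0 1 := fun y hy ↦
        ⟨hy.2.le.trans (min_le_left _ _), hy.1, hy.2.trans_le (min_le_right _ _)⟩
      exact (h1.eventuallyLE.trans_eq Ioo_ae_eq_Icc.symm).antisymm h2.eventuallyLE
    rw [h1, lintegral_Ioo_exp hr (le_min h zero_le_one), Set.indicator_of_mem (Set.mem_Iic.2 h),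
      Pi.one_apply, mul_one, ← ENNReal.ofReal_add (Real.exp_nonneg _)]
    · congr 1
      ring
    · rw [sub_nonneg, Real.exp_le_exp, neg_le_neg_iff]
      refine mul_le_of_le_one_right hr ?_
      linarith [le_min h zero_le_one]
  · rw [Set.indicator_of_notMem (by simpa using h)]
    have : Set.Iic t ∩ Set.Ioo 0 1 = ∅ := by
      ext y
      simp only [Set.mem_inter_iff, Set.mem_Iic, Set.mem_Ioo, Set.mem_empty_iff_false, iff_false]
      rintro ⟨h1, h2, -⟩
      exact h (h2.le.trans h1)
    simp [this]

lemma IsPoissonProcess.map_lastReset (hN : IsPoissonProcess N r P) :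
    P.map (fun ω ↦ (lastReset (fun t ↦ N t ω) : ℝ)) = lastResetMeasure r := by
  have := hN.isProbabilityMeasure
  have hmeas : Measurable fun ω ↦ (lastReset (fun t ↦ N t ω) : ℝ) :=
    (measurable_lastReset.comp hN.measurable_path).coe_nnreal_real
  have := Measure.isProbabilityMeasure_map (μ := P) hmeas.aemeasurable
  refine Measure.ext_of_Iic _ _ fun t ↦ ?_
  rw [lastResetMeasure_Iic r.coe_nonneg, Measure.map_apply hmeas measurableSet_Iic]
  split_ifs with h
  · lift t to ℝ≥0 using h
    have h1 : P ((fun ω ↦ (lastReset (fun t ↦ N t ω) : ℝ)) ⁻¹' Set.Iic (t : ℝ)) =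
        P {ω | lastReset (fun t ↦ N t ω) ≤ min t 1} := by
      refine measure_congr ?_
      filter_upwards [hN.mono] with ω hω
      refine propext ?_
      change (lastReset (fun t ↦ N t ω) : ℝ) ≤ t ↔ lastReset (fun t ↦ N t ω) ≤ min t 1
      rw [NNReal.coe_le_coe, le_min_iff]
      exact ⟨fun h ↦ ⟨h, lastReset_le_one hω⟩, fun h ↦ h.1⟩
    rw [h1, hN.measure_lastReset_le (min_le_right _ _)]
    simp
  · have : (fun ω ↦ (lastReset (fun t ↦ N t ω) : ℝ)) ⁻¹' Set.Iic t = ∅ := by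
      ext ω
      simp only [Set.mem_preimage, Set.mem_Iic, Set.mem_empty_iff_false, iff_false, not_le]
      exact (not_le.1 h).trans_le (NNReal.coe_nonneg _)
    rw [this, measure_empty]

end LastReset

/-! ### The law of the last zero as a mixture of shifted arcsine laws. -/

section Law

variable {Ω : Type*} [MeasurableSpace Ω] {P : Measure Ω} {W : ℕ → ℝ≥0 → Ω → ℝ}
  {N : ℝ≥0 → Ω → ℕ} {r : ℝ≥0}

/-- The last zero of a Brownian path `w` run after the last reset of the counting path `n`. -/
noncomputable def lastZeroOfPaths (n : ℝ≥0 → ℕ) (w : ℝ≥0 → ℝ) : ℝ :=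
  lastReset n + (lastZeroBefore (1 - lastReset n) w).toReal

lemma measurable_lastZeroOfPaths :
    Measurable fun p : (ℝ≥0 → ℕ) × (ℝ≥0 → ℝ) ↦ lastZeroOfPaths p.1 p.2 := by
  have h : Measurable fun p : (ℝ≥0 → ℕ) × (ℝ≥0 → ℝ) ↦ lastReset p.1 :=
    measurable_lastReset.comp measurable_fst
  exact h.coe_nnreal_real.add (measurable_lastZeroBefore.comp
    ((measurable_const.sub h).prodMk measurable_snd)).ennreal_toReal

/-- The count is constant on [T,1], so there the process is the path `W k` shifted by T. This path
starts at 0, so T is a zero and all earlier zeros are irrelevant. -/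
lemma IsResettingModel.lastZero_ae_eq (hM : IsResettingModel W N r P) :
    ∀ᵐ ω ∂P, lastZero (resetProcess W N) ω =
      lastZeroOfPaths (fun t ↦ N t ω) (fun t ↦ W (N 1 ω) t ω) := by
  filter_upwards [hM.poisson.mono, hM.poisson.rightCont,
    ae_all_iff.2 fun k ↦ (hM.brownian k).cont,
    ae_all_iff.2 fun k ↦ (hM.brownian k).eval_zero_ae_eq_zero] with ω h1 h2 h3 h4
  set T := lastReset (fun t ↦ N t ω) with hT
  set k := N 1 ω with hk
  have hT1 : T ≤ 1 := lastReset_le_one h1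
  have hjump : jumpTime N k ω = T := (lastReset_eq_sInf h1).symm
  have hNk : ∀ t, T ≤ t → t ≤ 1 → N t ω = k := fun t ht ht1 ↦
    le_antisymm (h1 ht1) ((lastReset_le_iff h1 h2 t).1 ht)
  have hX : ∀ t, T ≤ t → t ≤ 1 → resetProcess W N t ω = W k (t - T) ω := by
    intro t ht ht1
    rw [resetProcess, hNk t ht ht1, hjump]
  have hbdd : BddAbove {t | t ≤ 1 - T ∧ W k t ω = 0} := ⟨1 - T, fun t ht ↦ ht.1⟩
  have hclosed : IsClosed {t | t ≤ 1 - T ∧ W k t ω = 0} :=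
    (isClosed_le continuous_id continuous_const).inter (isClosed_eq (h3 k) continuous_const)
  have hmem := hclosed.csSup_mem ⟨0, zero_le, h4 k⟩ hbdd
  set z := sSup {t | t ≤ 1 - T ∧ W k t ω = 0} with hz
  have hTz : T + z ≤ 1 := by
    have := add_le_add_right hmem.1 T
    rwa [add_tsub_cancel_of_le hT1] at this
  have hgr : IsGreatest {t : ℝ≥0 | t ≤ 1 ∧ resetProcess W N t ω = 0} (T + z) := by
    refine ⟨⟨hTz, ?_⟩, ?_⟩
    · rw [hX _ le_self_add hTz, add_tsub_cancel_left]
      exact hmem.2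
    · rintro t ⟨ht1, ht⟩
      rcases le_total t T with htT | htT
      · exact htT.trans le_self_add
      · rw [hX t htT ht1] at ht
        have := le_csSup hbdd ⟨tsub_le_tsub_right ht1 T, ht⟩
        exact tsub_le_iff_left.1 this
  rw [lastZero, hgr.csSup_eq, lastZeroOfPaths, lastZeroBefore_eq_sSup (h3 k) (h4 k)]
  simp [← hT, ← hz]

/-- The definition takes a supremum over uncountably many times; measurability is inherited from the
countable functional that agrees with it almost surely. The random index `N 1 ω` is admissible since
it takes countably many values. -/
lemma IsResettingModel.aemeasurable_lastZero (hM : IsResettingModel W N r P) :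
    AEMeasurable (lastZero (resetProcess W N)) P := by
  have h (t : ℝ≥0) : Measurable fun p : ℕ × Ω ↦ W p.1 t p.2 :=
    measurable_from_prod_countable_right fun k ↦ hM.measurable k t
  have hN : Measurable fun ω ↦ (N 1 ω, ω) := (hM.poisson.measurable 1).prodMk measurable_id
  have hW : Measurable fun ω t ↦ W (N 1 ω) t ω := measurable_pi_lambda _ fun t ↦ (h t).comp hN
  have hp : Measurable fun ω ↦ ((fun t ↦ N t ω), (fun t ↦ W (N 1 ω) t ω)) :=
    hM.poisson.measurable_path.prodMk hW
  have hL := (measurable_lastZeroOfPaths.comp hp).aemeasurable (μ := P)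
  refine hL.congr ?_
  filter_upwards [hM.lastZero_ae_eq] with ω hω
  rw [hω, Function.comp_apply]

/-- The expectation of `f` at the last zero on `[0, 1]` given that the last reset is at `c`. -/
noncomputable def arcsineExpectation (f : ℝ → ENNReal) (c : ℝ) : ENNReal :=
  ∫⁻ y in Set.Ioo c 1, ENNReal.ofReal (1 / (Real.pi * √((y - c) * (1 - y)))) * f y

lemma measurable_arcsineExpectation {f : ℝ → ENNReal} (hf : Measurable f) :
    Measurable (arcsineExpectation f) := by
  have h : arcsineExpectation f = fun c ↦ ∫⁻ y, {p : ℝ × ℝ | p.1 < p.2 ∧ p.2 < 1}.indicator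
      (fun p ↦ ENNReal.ofReal (1 / (Real.pi * √((p.2 - p.1) * (1 - p.2)))) * f p.2) (c, y) := by
    ext c
    rw [arcsineExpectation, ← lintegral_indicator measurableSet_Ioo]
    rfl
  rw [h]
  refine Measurable.lintegral_prod_right' (f := {p : ℝ × ℝ | p.1 < p.2 ∧ p.2 < 1}.indicator
      (fun p ↦ ENNReal.ofReal (1 / (Real.pi * √((p.2 - p.1) * (1 - p.2)))) * f p.2)) ?_
  refine Measurable.indicator (by fun_prop) ?_
  exact (measurableSet_lt measurable_fst measurable_snd).inter
    (measurableSet_lt measurable_snd measurable_const)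

/-- The law of the last zero of Brownian motion under Poissonian resetting. -/
theorem IsResettingModel.lintegral_lastZero (hM : IsResettingModel W N r P)
    {f : ℝ → ENNReal} (hf : Measurable f) :
    ∫⁻ ω, f (lastZero (resetProcess W N) ω) ∂P =
      ∫⁻ c, arcsineExpectation f c ∂(lastResetMeasure r) := by
  have := hM.poisson.isProbabilityMeasure
  have hNm := hM.poisson.measurable_path
  have hWm (k : ℕ) : Measurable fun ω t ↦ W k t ω := measurable_pi_lambda _ (hM.measurable k)
  have hΨ : Measurable fun p : (ℝ≥0 → ℕ) × (ℝ≥0 → ℝ) ↦ f (lastZeroOfPaths p.1 p.2) :=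
    hf.comp measurable_lastZeroOfPaths
  have hmT : Measurable fun ω ↦ (lastReset (fun t ↦ N t ω) : ℝ) :=
    (measurable_lastReset.comp hNm).coe_nnreal_real
  -- The arcsine law needs a positive remaining duration 1 - T, and the law of T has no atom at 1.
  have hlt : ∀ᵐ ω ∂P, lastReset (fun t ↦ N t ω) < 1 := by
    have h0 : P.map (fun ω ↦ (lastReset (fun t ↦ N t ω) : ℝ)) {1} = 0 := by
      rw [hM.poisson.map_lastReset, lastResetMeasure]
      simp
    rw [Measure.map_apply hmT (measurableSet_singleton 1)] at h0
    filter_upwards [hM.poisson.mono, measure_eq_zero_iff_ae_notMem.1 h0] with ω h1 h2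
    refine lt_of_le_of_ne (lastReset_le_one h1) fun h ↦ h2 ?_
    simp [h]
  -- On the event that `N 1` equals `k` the driving path is the fixed `W k`, independent of N. The
  -- joint law is then a product, and for a frozen counting path the inner integral is an arcsine
  -- expectation.
  have hk (k : ℕ) : ∫⁻ ω, ((fun ω ↦ N 1 ω) ⁻¹' {k}).indicator
        (fun ω ↦ f (lastZeroOfPaths (fun t ↦ N t ω) (fun t ↦ W k t ω))) ω ∂P =
      ∫⁻ ω, ((fun ω ↦ N 1 ω) ⁻¹' {k}).indicator
        (fun ω ↦ arcsineExpectation f (lastReset (fun t ↦ N t ω))) ω ∂P := by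
    have hind : (fun ω t ↦ N t ω) ⟂ᵢ[P] (fun ω t ↦ W k t ω) :=
      (hM.indep.comp (measurable_pi_apply k) measurable_id).symm
    have hprod := (indepFun_iff_map_prod_eq_prod_map_map hNm.aemeasurable
      (hWm k).aemeasurable).1 hind
    set S : Set ((ℝ≥0 → ℕ) × (ℝ≥0 → ℝ)) := (fun p ↦ p.1 1) ⁻¹' {k} with hS
    have hSm : MeasurableSet S :=
      ((measurable_pi_apply 1).comp measurable_fst) (measurableSet_singleton k)
    have hF := hΨ.indicator hSm
    calc _ = ∫⁻ ω, (S.indicator fun p ↦ f (lastZeroOfPaths p.1 p.2))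
            (fun t ↦ N t ω, fun t ↦ W k t ω) ∂P := rfl
      _ = ∫⁻ p, (S.indicator fun p ↦ f (lastZeroOfPaths p.1 p.2)) p
            ∂((P.map fun ω t ↦ N t ω).prod (P.map fun ω t ↦ W k t ω)) := by
          rw [← hprod, lintegral_map hF (hNm.prodMk (hWm k))]
      _ = ∫⁻ ω, ∫⁻ ω', (S.indicator fun p ↦ f (lastZeroOfPaths p.1 p.2))
            (fun t ↦ N t ω, fun t ↦ W k t ω') ∂P ∂P := by
          rw [lintegral_prod _ hF.aemeasurable, lintegral_map hF.lintegral_prod_right' hNm]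
          refine lintegral_congr fun ω ↦ ?_
          exact lintegral_map (f := fun y ↦ (S.indicator fun p ↦ f (lastZeroOfPaths p.1 p.2))
            (fun t ↦ N t ω, y)) (hF.comp measurable_prodMk_left) (hWm k)
      _ = _ := by
          refine lintegral_congr_ae ?_
          filter_upwards [hlt] with ω hω
          by_cases hωk : N 1 ω = k
          · rw [Set.indicator_of_mem (by exact hωk)]
            have h1 : ∀ ω', (S.indicator fun p ↦ f (lastZeroOfPaths p.1 p.2))
                (fun t ↦ N t ω, fun t ↦ W k t ω') =
                f (lastZeroOfPaths (fun t ↦ N t ω) (fun t ↦ W k t ω')) := fun ω' ↦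
              Set.indicator_of_mem (by exact hωk) _
            simp_rw [h1, lastZeroOfPaths]
            rw [lintegral_add_lastZeroBefore (hM.brownian k) (hM.measurable k)
              (tsub_pos_of_lt hω).ne' hf, arcsineExpectation, NNReal.coe_sub hω.le]
            simp
          · rw [Set.indicator_of_notMem (by exact hωk)]
            have h1 : ∀ ω', (S.indicator fun p ↦ f (lastZeroOfPaths p.1 p.2))
                (fun t ↦ N t ω, fun t ↦ W k t ω') = 0 := fun ω' ↦
              Set.indicator_of_notMem (by exact hωk) _
            simp [h1]
  have hsum (F : ℕ → Ω → ENNReal) (ω : Ω) : F (N 1 ω) ω =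
      ∑' k, ((fun ω ↦ N 1 ω) ⁻¹' {k}).indicator (F k) ω := by
    rw [tsum_eq_single (N 1 ω)]
    · rw [Set.indicator_of_mem (by simp)]
    · intro k hk
      rw [Set.indicator_of_notMem (by simpa using hk.symm)]
  have hNk (k : ℕ) : MeasurableSet ((fun ω ↦ N 1 ω) ⁻¹' {k}) :=
    hM.poisson.measurable 1 (measurableSet_singleton k)
  rw [← hM.poisson.map_lastReset, lintegral_map (measurable_arcsineExpectation hf) hmT]
  calc _ = ∫⁻ ω, f (lastZeroOfPaths (fun t ↦ N t ω) (fun t ↦ W (N 1 ω) t ω)) ∂P := by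
        refine lintegral_congr_ae ?_
        filter_upwards [hM.lastZero_ae_eq] with ω hω
        rw [hω]
    _ = _ := by
        rw [lintegral_congr (hsum fun k ω ↦ f (lastZeroOfPaths (fun t ↦ N t ω) (fun t ↦ W k t ω))),
          lintegral_congr (hsum fun k ω ↦ arcsineExpectation f (lastReset (fun t ↦ N t ω))),
          lintegral_tsum, lintegral_tsum]
        · simp_rw [hk]
        · exact fun k ↦ (((measurable_arcsineExpectation hf).comp hmT).indicator
            (hNk k)).aemeasurable
        · exact fun k ↦ ((hΨ.comp (hNm.prodMk (hWm k))).indicator (hNk k)).aemeasurable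

end Law

/-! ### Beta integrals and the series for the moments. -/

section Moments

/-- A reading of the fact that the Beta density has total mass 1. -/
lemma lintegral_Ioo_rpow_mul_rpow {a b : ℝ} (ha : 0 < a) (hb : 0 < b) :
    ∫⁻ x in Set.Ioo (0 : ℝ) 1, ENNReal.ofReal (x ^ (a - 1) * (1 - x) ^ (b - 1)) =
      ENNReal.ofReal (beta a b) := by
  have hβ := beta_pos ha hb
  have h := lintegral_betaPDF_eq_one ha hb
  rw [lintegral_betaPDF] at h
  have h1 : ∀ x ∈ Set.Ioo (0 : ℝ) 1,
      ENNReal.ofReal (1 / beta a b * x ^ (a - 1) * (1 - x) ^ (b - 1)) =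
      ENNReal.ofReal (1 / beta a b) * ENNReal.ofReal (x ^ (a - 1) * (1 - x) ^ (b - 1)) := by
    intro x _
    rw [mul_assoc, ENNReal.ofReal_mul (by positivity)]
  rw [setLIntegral_congr_fun measurableSet_Ioo h1,
    lintegral_const_mul' _ _ ENNReal.ofReal_ne_top] at h
  calc _ = ENNReal.ofReal (beta a b) * (ENNReal.ofReal (1 / beta a b) *
        ∫⁻ x in Set.Ioo (0 : ℝ) 1, ENNReal.ofReal (x ^ (a - 1) * (1 - x) ^ (b - 1))) := by
        rw [← mul_assoc, ← ENNReal.ofReal_mul hβ.le, mul_one_div_cancel hβ.ne',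
          ENNReal.ofReal_one, one_mul]
    _ = _ := by rw [h, mul_one]

lemma lintegral_Ioo_rpow_mul_sub_rpow {a b y : ℝ} (ha : 0 < a) (hb : 0 < b) (hy : 0 < y) :
    ∫⁻ c in Set.Ioo (0 : ℝ) y, ENNReal.ofReal (c ^ (a - 1) * (y - c) ^ (b - 1)) =
      ENNReal.ofReal (y ^ (a + b - 1) * beta a b) := by
  have himg : (fun x : ℝ ↦ y * x) '' Set.Ioo 0 1 = Set.Ioo 0 y := by
    rw [Set.image_mul_left_Ioo hy, mul_zero, mul_one]
  have hd : ∀ x ∈ Set.Ioo (0 : ℝ) 1,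
      HasDerivWithinAt (fun x : ℝ ↦ y * x) y (Set.Ioo 0 1) x := by
    intro w _
    simpa using ((hasDerivAt_id w).const_mul y).hasDerivWithinAt
  have hinj : Set.InjOn (fun x : ℝ ↦ y * x) (Set.Ioo 0 1) :=
    fun a _ b _ h ↦ mul_left_cancel₀ hy.ne' h
  rw [← himg, lintegral_image_eq_lintegral_abs_deriv_mul measurableSet_Ioo hd hinj,
    ENNReal.ofReal_mul (by positivity), ← lintegral_Ioo_rpow_mul_rpow ha hb,
    ← lintegral_const_mul' _ _ ENNReal.ofReal_ne_top]
  refine setLIntegral_congr_fun measurableSet_Ioo fun x hx ↦ ?_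
  have hx1 : 0 < 1 - x := sub_pos.2 hx.2
  have hx0 : 0 < x := hx.1
  rw [abs_of_pos hy, ← ENNReal.ofReal_mul hy.le, ← ENNReal.ofReal_mul (by positivity)]
  congr 1
  rw [show y - y * x = y * (1 - x) by ring, Real.mul_rpow hy.le hx0.le,
    Real.mul_rpow hy.le hx1.le, show a + b - 1 = 1 + (a - 1) + (b - 1) by ring,
    Real.rpow_add hy, Real.rpow_add hy, Real.rpow_one]
  ring

lemma one_div_pi_mul_sqrt {x y : ℝ} (hx : 0 < x) (hy : 0 < y) :
    1 / (Real.pi * √(x * y)) =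
      1 / Real.pi * (x ^ ((1 / 2 : ℝ) - 1) * y ^ ((1 / 2 : ℝ) - 1)) := by
  rw [Real.sqrt_mul hx.le, show (1 / 2 : ℝ) - 1 = -(1 / 2) by norm_num, Real.rpow_neg hx.le,
    Real.rpow_neg hy.le, ← Real.sqrt_eq_rpow, ← Real.sqrt_eq_rpow]
  field_simp

lemma arcsineExpectation_pow_zero (n : ℕ) :
    arcsineExpectation (fun y ↦ ENNReal.ofReal (y ^ n)) 0 =
      ENNReal.ofReal (Real.Gamma (1 / 2 + n) / (√Real.pi * Real.Gamma (1 + n))) := by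
  have h1 : ∀ y ∈ Set.Ioo (0 : ℝ) 1,
      ENNReal.ofReal (1 / (Real.pi * √((y - 0) * (1 - y)))) * ENNReal.ofReal (y ^ n) =
      ENNReal.ofReal (1 / Real.pi) *
        ENNReal.ofReal (y ^ ((1 / 2 + n : ℝ) - 1) * (1 - y) ^ ((1 / 2 : ℝ) - 1)) := by
    intro y hy
    have hy1 : 0 < 1 - y := sub_pos.2 hy.2
    have hy0 : 0 < y := hy.1
    rw [← ENNReal.ofReal_mul (by positivity), ← ENNReal.ofReal_mul (by positivity), sub_zero,
      one_div_pi_mul_sqrt hy0 hy1, show (1 / 2 + n : ℝ) - 1 = (1 / 2 - 1) + n by ring,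
      Real.rpow_add hy0, Real.rpow_natCast]
    congr 1
    ring
  rw [arcsineExpectation, setLIntegral_congr_fun measurableSet_Ioo h1,
    lintegral_const_mul' _ _ ENNReal.ofReal_ne_top,
    lintegral_Ioo_rpow_mul_rpow (by positivity) (by norm_num),
    ← ENNReal.ofReal_mul (by positivity)]
  congr 1
  rw [beta, Real.Gamma_one_half_eq, show (1 / 2 + n + 1 / 2 : ℝ) = 1 + n by ring]
  have hπ := Real.sq_sqrt Real.pi_pos.le
  have hG : Real.Gamma (1 + n) ≠ 0 := (Real.Gamma_pos_of_pos (by positivity)).ne'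
  field_simp
  rw [hπ]

/-- Integration of a power of the last reset against the conditional moments. -/
lemma lintegral_pow_mul_arcsineExpectation (k n : ℕ) :
    ∫⁻ c in Set.Ioo (0 : ℝ) 1, ENNReal.ofReal (c ^ k) *
      arcsineExpectation (fun y ↦ ENNReal.ofReal (y ^ n)) c =
      ENNReal.ofReal (k.factorial * (Real.Gamma (3 / 2 + n + k) /
        (Real.Gamma (3 / 2 + k) * Real.Gamma (2 + n + k)))) := by
  set F : ℝ × ℝ → ENNReal := {p : ℝ × ℝ | 0 < p.1 ∧ p.1 < p.2 ∧ p.2 < 1}.indicator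
    fun p ↦ ENNReal.ofReal (p.1 ^ k) *
      (ENNReal.ofReal (1 / (Real.pi * √((p.2 - p.1) * (1 - p.2)))) * ENNReal.ofReal (p.2 ^ n))
    with hF
  have hFm : Measurable F := by
    refine Measurable.indicator (by fun_prop) ?_
    exact (measurableSet_lt measurable_const measurable_fst).inter
      ((measurableSet_lt measurable_fst measurable_snd).inter
      (measurableSet_lt measurable_snd measurable_const))
  have h1 : ∫⁻ c in Set.Ioo (0 : ℝ) 1, ENNReal.ofReal (c ^ k) *
      arcsineExpectation (fun y ↦ ENNReal.ofReal (y ^ n)) c = ∫⁻ c, ∫⁻ y, F (c, y) := by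
    rw [← lintegral_indicator measurableSet_Ioo]
    refine lintegral_congr fun c ↦ ?_
    by_cases hc : c ∈ Set.Ioo (0 : ℝ) 1
    · rw [Set.indicator_of_mem hc, arcsineExpectation,
        ← lintegral_const_mul' _ _ ENNReal.ofReal_ne_top, ← lintegral_indicator measurableSet_Ioo]
      refine lintegral_congr fun y ↦ ?_
      by_cases hy : y ∈ Set.Ioo c 1
      · rw [Set.indicator_of_mem hy, hF,
          Set.indicator_of_mem (show (c, y) ∈ {p : ℝ × ℝ | 0 < p.1 ∧ p.1 < p.2 ∧ p.2 < 1} from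
            ⟨hc.1, hy⟩)]
      · rw [Set.indicator_of_notMem hy, hF, Set.indicator_of_notMem]
        exact fun h ↦ hy h.2
    · rw [Set.indicator_of_notMem hc]
      have h0 : ∀ y, F (c, y) = 0 := fun y ↦
        Set.indicator_of_notMem (fun h ↦ hc ⟨h.1, h.2.1.trans h.2.2⟩) _
      simp_rw [h0, lintegral_zero]
  -- With `y` fixed, the integral of c^k (y-c)^(-1/2) over (0,y) is y^(k+1/2) times Beta(k+1, 1/2).
  -- The remaining `y` integral is Beta(3/2+n+k, 1/2), and the two factors Γ(1/2) cancel the π.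
  have h2 : ∀ y, ∫⁻ c, F (c, y) = (Set.Ioo (0 : ℝ) 1).indicator (fun y ↦
      ENNReal.ofReal (1 / Real.pi * beta (k + 1) (1 / 2)) *
      ENNReal.ofReal (y ^ ((3 / 2 + n + k : ℝ) - 1) * (1 - y) ^ ((1 / 2 : ℝ) - 1))) y := by
    intro y
    by_cases hy : y ∈ Set.Ioo (0 : ℝ) 1
    · have hy1 : 0 < 1 - y := sub_pos.2 hy.2
      have hy0 : 0 < y := hy.1
      have hβ := beta_pos (α := k + 1) (β := 1 / 2) (by positivity) (by norm_num)
      have h3 : ∀ c, F (c, y) = (Set.Ioo (0 : ℝ) y).indicator (fun c ↦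
          ENNReal.ofReal (1 / Real.pi * (1 - y) ^ ((1 / 2 : ℝ) - 1) * y ^ n) *
            ENNReal.ofReal (c ^ ((k + 1 : ℝ) - 1) * (y - c) ^ ((1 / 2 : ℝ) - 1))) c := by
        intro c
        by_cases hc : c ∈ Set.Ioo (0 : ℝ) y
        · have hc0 : 0 < c := hc.1
          have hyc : 0 < y - c := sub_pos.2 hc.2
          rw [Set.indicator_of_mem hc, hF,
            Set.indicator_of_mem (show (c, y) ∈ {p : ℝ × ℝ | 0 < p.1 ∧ p.1 < p.2 ∧ p.2 < 1} from
              ⟨hc.1, hc.2, hy.2⟩), ← ENNReal.ofReal_mul (by positivity),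
            ← ENNReal.ofReal_mul (by positivity), ← ENNReal.ofReal_mul (by positivity),
            one_div_pi_mul_sqrt hyc hy1, add_sub_cancel_right, Real.rpow_natCast]
          congr 1
          ring
        · rw [Set.indicator_of_notMem hc, hF, Set.indicator_of_notMem]
          exact fun h ↦ hc ⟨h.1, h.2.1⟩
      simp_rw [h3]
      rw [lintegral_indicator measurableSet_Ioo, lintegral_const_mul' _ _ ENNReal.ofReal_ne_top,
        lintegral_Ioo_rpow_mul_sub_rpow (by positivity) (by norm_num) hy0,
        Set.indicator_of_mem hy, ← ENNReal.ofReal_mul (by positivity),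
        ← ENNReal.ofReal_mul (by positivity)]
      congr 1
      rw [show (3 / 2 + n + k : ℝ) - 1 = ((k + 1 : ℝ) + 1 / 2 - 1) + n by ring,
        Real.rpow_add hy0, Real.rpow_natCast]
      ring
    · have h0 : ∀ c, F (c, y) = 0 := fun c ↦
        Set.indicator_of_notMem (fun h ↦ hy ⟨h.1.trans h.2.1, h.2.2⟩) _
      simp_rw [Set.indicator_of_notMem hy, h0, lintegral_zero]
  rw [h1, lintegral_lintegral_swap (f := fun c y ↦ F (c, y)) hFm.aemeasurable]
  simp_rw [h2]
  have hβ := beta_pos (α := k + 1) (β := 1 / 2) (by positivity) (by norm_num)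
  rw [lintegral_indicator measurableSet_Ioo, lintegral_const_mul' _ _ ENNReal.ofReal_ne_top,
    lintegral_Ioo_rpow_mul_rpow (by positivity) (by norm_num), ← ENNReal.ofReal_mul (by positivity)]
  congr 1
  rw [beta, beta, Real.Gamma_one_half_eq, Real.Gamma_nat_eq_factorial,
    show (k + 1 + 1 / 2 : ℝ) = 3 / 2 + k by ring,
    show (3 / 2 + n + k + 1 / 2 : ℝ) = 2 + n + k by ring]
  have hπ := Real.sq_sqrt Real.pi_pos.le
  have hG1 : Real.Gamma (3 / 2 + k) ≠ 0 := (Real.Gamma_pos_of_pos (by positivity)).ne'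
  have hG2 : Real.Gamma (2 + n + k) ≠ 0 := (Real.Gamma_pos_of_pos (by positivity)).ne'
  field_simp
  rw [hπ]

/-- The coefficients in the series for the moments of the last zero. -/
noncomputable def momentCoeff (r : ℝ) (n k : ℕ) : ℝ :=
  r ^ (k + 1) * (Real.Gamma (3 / 2 + n + k) / (Real.Gamma (3 / 2 + k) * Real.Gamma (2 + n + k)))

lemma momentCoeff_nonneg {r : ℝ} (hr : 0 ≤ r) (n k : ℕ) : 0 ≤ momentCoeff r n k := by
  have h1 := Real.Gamma_pos_of_pos (show (0 : ℝ) < 3 / 2 + n + k by positivity)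
  have h2 := Real.Gamma_pos_of_pos (show (0 : ℝ) < 3 / 2 + k by positivity)
  have h3 := Real.Gamma_pos_of_pos (show (0 : ℝ) < 2 + n + k by positivity)
  unfold momentCoeff
  positivity

/-- The atom at 0 gives the first summand. In the density, exp(-r(1-c)) is exp(-r) times the power
series of exp(rc); its 1/k! cancels the factorial from the Beta integrals. -/
lemma lintegral_arcsineExpectation_pow {r : ℝ} (hr : 0 ≤ r) (n : ℕ) :
    ∫⁻ c, arcsineExpectation (fun y ↦ ENNReal.ofReal (y ^ n)) c ∂(lastResetMeasure r) =
      ENNReal.ofReal (Real.exp (-r)) *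
        (ENNReal.ofReal (Real.Gamma (1 / 2 + n) / (√Real.pi * Real.Gamma (1 + n))) +
          ∑' k, ENNReal.ofReal (momentCoeff r n k)) := by
  have hm : Measurable (arcsineExpectation fun y ↦ ENNReal.ofReal (y ^ n)) :=
    measurable_arcsineExpectation (by fun_prop)
  rw [lastResetMeasure, lintegral_add_measure, lintegral_smul_measure, lintegral_dirac' _ hm,
    arcsineExpectation_pow_zero, lintegral_withDensity_eq_lintegral_mul _ (by fun_prop) hm,
    mul_add, smul_eq_mul]
  congr 1
  have h1 : ∀ c ∈ Set.Ioo (0 : ℝ) 1,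
      ((fun c ↦ ENNReal.ofReal (r * Real.exp (-(r * (1 - c))))) *
        arcsineExpectation fun y ↦ ENNReal.ofReal (y ^ n)) c =
      ∑' k : ℕ, ENNReal.ofReal (Real.exp (-r) * (r ^ (k + 1) / k.factorial)) *
        (ENNReal.ofReal (c ^ k) * arcsineExpectation (fun y ↦ ENNReal.ofReal (y ^ n)) c) := by
    intro c hc
    have hc0 : 0 < c := hc.1
    simp only [Pi.mul_apply]
    have h2 : HasSum (fun k : ℕ ↦ Real.exp (-r) * (r ^ (k + 1) / k.factorial) * c ^ k)
        (r * Real.exp (-(r * (1 - c)))) := by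
      have h3 := (NormedSpace.expSeries_div_hasSum_exp (𝔸 := ℝ) (r * c)).mul_left
        (r * Real.exp (-r))
      rw [← Real.exp_eq_exp_ℝ, mul_assoc, ← Real.exp_add] at h3
      convert! h3 using 1
      · ext k
        rw [mul_pow, pow_succ]
        ring
      · congr 2
        ring
    rw [← h2.tsum_eq, ENNReal.ofReal_tsum_of_nonneg (fun k ↦ by positivity) h2.summable,
      ← ENNReal.tsum_mul_right]
    refine tsum_congr fun k ↦ ?_
    rw [ENNReal.ofReal_mul (by positivity), mul_assoc]
  rw [setLIntegral_congr_fun measurableSet_Ioo h1, lintegral_tsum fun k ↦ by fun_prop,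
    ← ENNReal.tsum_mul_left]
  refine tsum_congr fun k ↦ ?_
  rw [lintegral_const_mul' _ _ ENNReal.ofReal_ne_top, lintegral_pow_mul_arcsineExpectation,
    ← ENNReal.ofReal_mul (by positivity), ← ENNReal.ofReal_mul (by positivity)]
  congr 1
  unfold momentCoeff
  field_simp

variable {Ω : Type*} [MeasurableSpace Ω] {P : Measure Ω} {W : ℕ → ℝ≥0 → Ω → ℝ}
  {N : ℝ≥0 → Ω → ℕ} {r : ℝ≥0}

lemma lastZero_nonneg {α : Type*} (X : ℝ≥0 → α → ℝ) (ω : α) : 0 ≤ lastZero X ω :=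
  NNReal.coe_nonneg _

lemma lastZero_le_one {α : Type*} (X : ℝ≥0 → α → ℝ) (ω : α) : lastZero X ω ≤ 1 := by
  refine NNReal.coe_le_one.2 ?_
  rcases Set.eq_empty_or_nonempty {t : ℝ≥0 | t ≤ 1 ∧ X t ω = 0} with h | h
  · rw [h, csSup_empty]
    exact zero_le
  · exact csSup_le h fun t ht ↦ ht.1

lemma IsResettingModel.integrable_pow (hM : IsResettingModel W N r P) (n : ℕ) :
    Integrable (fun ω ↦ lastZero (resetProcess W N) ω ^ n) P := by
  have := hM.poisson.isProbabilityMeasure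
  refine Integrable.of_bound (hM.aemeasurable_lastZero.pow_const n).aestronglyMeasurable 1
    (ae_of_all _ fun ω ↦ ?_)
  rw [Real.norm_of_nonneg (pow_nonneg (lastZero_nonneg _ _) n)]
  exact pow_le_one₀ (lastZero_nonneg _ _) (lastZero_le_one _ _)

/-- The moments of the last zero, as a series. -/
theorem IsResettingModel.hasSum_moment (hM : IsResettingModel W N r P) (n : ℕ) :
    HasSum (momentCoeff r n)
      (Real.exp r * ∫ ω, lastZero (resetProcess W N) ω ^ n ∂P -
        Real.Gamma (1 / 2 + n) / (√Real.pi * Real.Gamma (1 + n))) := by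
  have hint := hM.integrable_pow n
  have h1 := hM.lintegral_lastZero (f := fun y ↦ ENNReal.ofReal (y ^ n)) (by fun_prop)
  rw [lintegral_arcsineExpectation_pow r.coe_nonneg, ← ofReal_integral_eq_lintegral_ofReal hint
    (ae_of_all _ fun ω ↦ pow_nonneg (lastZero_nonneg _ _) n)] at h1
  have hI : 0 ≤ ∫ ω, lastZero (resetProcess W N) ω ^ n ∂P :=
    integral_nonneg fun ω ↦ pow_nonneg (lastZero_nonneg _ _) n
  have hG : 0 ≤ Real.Gamma (1 / 2 + n) / (√Real.pi * Real.Gamma (1 + n)) := by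
    have h1 := Real.Gamma_pos_of_pos (show (0 : ℝ) < 1 / 2 + n by positivity)
    have h2 := Real.Gamma_pos_of_pos (show (0 : ℝ) < 1 + n by positivity)
    positivity
  -- Convergence of the series is read off from the finiteness of the moment, with no growth
  -- estimate.
  have hne : ∑' k, ENNReal.ofReal (momentCoeff r n k) ≠ ⊤ := by
    intro h
    rw [h, add_top, ENNReal.mul_top (by simp [Real.exp_pos])] at h1
    exact ENNReal.ofReal_ne_top h1
  have hsum : Summable (momentCoeff r n) := by
    have := ENNReal.summable_toReal hne
    simpa only [ENNReal.toReal_ofReal (momentCoeff_nonneg r.coe_nonneg n _)] using this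
  have h2 := congrArg ENNReal.toReal h1
  rw [← ENNReal.ofReal_tsum_of_nonneg (momentCoeff_nonneg r.coe_nonneg n) hsum,
    ← ENNReal.ofReal_add hG (tsum_nonneg (momentCoeff_nonneg r.coe_nonneg n)),
    ← ENNReal.ofReal_mul (Real.exp_nonneg _), ENNReal.toReal_ofReal hI,
    ENNReal.toReal_ofReal (mul_nonneg (Real.exp_nonneg _)
      (add_nonneg hG (tsum_nonneg (momentCoeff_nonneg r.coe_nonneg n))))] at h2
  convert hsum.hasSum using 1
  rw [h2, ← mul_assoc, ← Real.exp_add]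
  simp

end Moments

/-! ### Identification with the regularized hypergeometric function. -/

section HypergeometricSeries

lemma regularizedHGFun_eq_tsum (a b : Multiset ℂ) (z : ℂ) :
    Complex.regularizedHGFun a b z = ∑' k, Complex.regularizedHGFunCoeff a b k * z ^ k := by
  rw [Complex.regularizedHGFun, FormalMultilinearSeries.sum]
  refine tsum_congr fun k ↦ ?_
  rw [Complex.regularizedHGFunSeries, FormalMultilinearSeries.ofScalars_apply_eq, smul_eq_mul]

/-- The rising factorial of 1 is k!, which cancels the 1/k! of the series. That of 3/2+n is
Γ(3/2+n+k)/Γ(3/2+n), whence the prefactor Γ(3/2+n). -/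
lemma ofReal_momentCoeff (r : ℝ) (n k : ℕ) :
    ((momentCoeff r n k : ℝ) : ℂ) = ((r * Real.Gamma (3 / 2 + n) : ℝ) : ℂ) *
      (Complex.regularizedHGFunCoeff {1, 3 / 2 + (n : ℂ)} {3 / 2, 2 + (n : ℂ)} k * (r : ℂ) ^ k) := by
  have hpos : (0 : ℝ) < 3 / 2 + n := by positivity
  have hc : ∀ m : ℕ, (3 / 2 + n : ℂ) ≠ -m := by
    intro m h
    have h1 : (3 / 2 + n : ℝ) = -m := by
      apply Complex.ofReal_injective
      push_cast
      exact h
    have h2 : (0 : ℝ) ≤ m := m.cast_nonneg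
    linarith
  have h1 := Complex.Gamma_add_nat_div_Gamma_eq (3 / 2 + n : ℂ) hc (n := k)
  have h2 : Complex.Gamma (3 / 2 + n) ≠ 0 := Complex.Gamma_ne_zero hc
  rw [div_eq_iff h2] at h1
  simp only [Complex.regularizedHGFunCoeff, Multiset.insert_eq_cons, Multiset.map_cons,
    Multiset.map_singleton, Multiset.prod_cons, Multiset.prod_singleton, ascPochhammer_eval_one]
  rw [momentCoeff]
  push_cast [← Complex.Gamma_ofReal]
  rw [h1]
  have h3 : (k.factorial : ℂ) ≠ 0 := by exact_mod_cast k.factorial_ne_zero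
  field_simp
  ring

variable {Ω : Type*} [MeasurableSpace Ω] {P : Measure Ω} {W : ℕ → ℝ≥0 → Ω → ℝ}
  {N : ℝ≥0 → Ω → ℕ} {r : ℝ≥0}

/-- The moments of the last zero in terms of the regularized hypergeometric function. -/
theorem IsResettingModel.moment_eq (hM : IsResettingModel W N r P) (n : ℕ) :
    ((∫ ω, lastZero (resetProcess W N) ω ^ n ∂P : ℝ) : ℂ) =
      (Real.exp (-r) : ℂ) *
        ((Real.Gamma (1 / 2 + n) / (√Real.pi * Real.Gamma (1 + n)) : ℝ)
          + ((r : ℝ) * Real.Gamma (3 / 2 + n) : ℝ) *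
            Complex.regularizedHGFun {1, 3 / 2 + (n : ℂ)} {3 / 2, 2 + (n : ℂ)}
              ((r : ℝ) : ℂ)) := by
  have h1 := (hM.hasSum_moment n).tsum_eq
  have h2 : ∫ ω, lastZero (resetProcess W N) ω ^ n ∂P = Real.exp (-r) *
      (Real.Gamma (1 / 2 + n) / (√Real.pi * Real.Gamma (1 + n)) + ∑' k, momentCoeff r n k) := by
    rw [h1, add_sub_cancel, ← mul_assoc, ← Real.exp_add]
    simp
  rw [h2, Complex.ofReal_mul, Complex.ofReal_add, Complex.ofReal_tsum,
    regularizedHGFun_eq_tsum, ← tsum_mul_left]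
  simp_rw [ofReal_momentCoeff]

end HypergeometricSeries

/-! ### Closed forms for the first two moments and their limits. -/

section MeanAndVariance

lemma hasSum_exp_shift (r : ℝ) (m : ℕ) :
    HasSum (fun k : ℕ ↦ r ^ (k + m) / (k + m).factorial)
      (Real.exp r - ∑ i ∈ Finset.range m, r ^ i / i.factorial) := by
  have h := NormedSpace.expSeries_div_hasSum_exp (𝔸 := ℝ) r
  rw [← Real.exp_eq_exp_ℝ] at h
  exact (hasSum_nat_add_iff' m).2 h

/-- The Gamma quotient is (k+3/2)/(k+2)!, and k + 3/2 = (k+2) - 1/2. -/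
lemma momentCoeff_one {r : ℝ} (hr : r ≠ 0) (k : ℕ) :
    momentCoeff r 1 k = r ^ (k + 1) / (k + 1).factorial -
      1 / (2 * r) * (r ^ (k + 2) / (k + 2).factorial) := by
  have h1 : Real.Gamma (3 / 2 + (1 : ℕ) + k) = (3 / 2 + k) * Real.Gamma (3 / 2 + k) := by
    rw [← Real.Gamma_add_one (by positivity)]
    congr 1
    push_cast
    ring
  have h2 : Real.Gamma (2 + (1 : ℕ) + k) = (k + 2).factorial := by
    rw [← Real.Gamma_nat_eq_factorial]
    congr 1
    push_cast
    ring
  have h3 : Real.Gamma (3 / 2 + k) ≠ 0 := (Real.Gamma_pos_of_pos (by positivity)).ne'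
  have h4 : ((k + 1).factorial : ℝ) ≠ 0 := by positivity
  have h5 : ((k + 2).factorial : ℝ) = (k + 2) * (k + 1).factorial := by
    rw [Nat.factorial_succ (k + 1)]
    push_cast
    ring
  rw [momentCoeff, h1, h2, h5]
  field_simp
  ring

/-- The Gamma quotient is (k+5/2)(k+3/2)/(k+3)!, and the numerator equals (k+3)(k+2) - (k+3) + 3/4.
-/
lemma momentCoeff_two {r : ℝ} (hr : r ≠ 0) (k : ℕ) :
    momentCoeff r 2 k = r ^ (k + 1) / (k + 1).factorial -
      1 / r * (r ^ (k + 2) / (k + 2).factorial) +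
      3 / (4 * r ^ 2) * (r ^ (k + 3) / (k + 3).factorial) := by
  have h1 : Real.Gamma (3 / 2 + (2 : ℕ) + k) =
      (5 / 2 + k) * ((3 / 2 + k) * Real.Gamma (3 / 2 + k)) := by
    rw [← Real.Gamma_add_one (by positivity),
      show (3 / 2 + k + 1 : ℝ) = 5 / 2 + k by ring, ← Real.Gamma_add_one (by positivity)]
    congr 1
    push_cast
    ring
  have h2 : Real.Gamma (2 + (2 : ℕ) + k) = (k + 3).factorial := by
    rw [← Real.Gamma_nat_eq_factorial]
    congr 1
    push_cast
    ring
  have h3 : Real.Gamma (3 / 2 + k) ≠ 0 := (Real.Gamma_pos_of_pos (by positivity)).ne'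
  have h4 : ((k + 1).factorial : ℝ) ≠ 0 := by positivity
  have h5 : ((k + 2).factorial : ℝ) = (k + 2) * (k + 1).factorial := by
    rw [Nat.factorial_succ (k + 1)]
    push_cast
    ring
  have h6 : ((k + 3).factorial : ℝ) = (k + 3) * ((k + 2) * (k + 1).factorial) := by
    rw [Nat.factorial_succ (k + 2), ← h5]
    push_cast
    ring
  rw [momentCoeff, h1, h2, h6, h5]
  field_simp
  ring

lemma Gamma_three_halves : Real.Gamma (3 / 2) = √Real.pi / 2 := by
  rw [show (3 / 2 : ℝ) = 1 / 2 + 1 by norm_num, Real.Gamma_add_one (by norm_num),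
    Real.Gamma_one_half_eq]
  ring

lemma Gamma_five_halves : Real.Gamma (5 / 2) = 3 * √Real.pi / 4 := by
  rw [show (5 / 2 : ℝ) = 3 / 2 + 1 by norm_num, Real.Gamma_add_one (by norm_num),
    Gamma_three_halves]
  ring

variable {Ω : Type*} [MeasurableSpace Ω] {P : Measure Ω} {W : ℕ → ℝ≥0 → Ω → ℝ}
  {N : ℝ≥0 → Ω → ℕ} {r : ℝ≥0}

theorem IsResettingModel.integral_lastZero (hM : IsResettingModel W N r P) (hr : 0 < r) :
    ∫ ω, lastZero (resetProcess W N) ω ∂P = 1 + (Real.exp (-r) - 1) / (2 * r) := by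
  have hr' : (r : ℝ) ≠ 0 := by positivity
  have h1 := hM.hasSum_moment 1
  rw [show momentCoeff r 1 = _ from funext (momentCoeff_one hr')] at h1
  simp only [pow_one] at h1
  have h2 := ((hasSum_exp_shift r 1).sub ((hasSum_exp_shift r 2).mul_left (1 / (2 * (r : ℝ)))))
  have h3 := h1.unique h2
  -- The mean of the arcsine law on [0,1]; its second moment is the 3/8 appearing in the computation
  -- of the square.
  have hG : Real.Gamma (1 / 2 + (1 : ℕ)) / (√Real.pi * Real.Gamma (1 + (1 : ℕ))) = 1 / 2 := by
    rw [show (1 / 2 + (1 : ℕ) : ℝ) = 3 / 2 by norm_num, Gamma_three_halves,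
      show (1 + (1 : ℕ) : ℝ) = 2 by norm_num, Real.Gamma_two]
    field_simp
  rw [hG] at h3
  simp only [Finset.sum_range_succ, Finset.sum_range_zero, Nat.factorial] at h3
  rw [Real.exp_neg]
  have hE := Real.exp_pos (r : ℝ)
  set E := Real.exp (r : ℝ)
  set m := ∫ ω, lastZero (resetProcess W N) ω ∂P
  refine mul_left_cancel₀ hE.ne' ?_
  rw [sub_eq_iff_eq_add.1 h3]
  field_simp
  push_cast
  ring

theorem IsResettingModel.integral_lastZero_sq (hM : IsResettingModel W N r P) (hr : 0 < r) :
    ∫ ω, lastZero (resetProcess W N) ω ^ 2 ∂P =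
      1 - 1 / r + 3 / (4 * (r : ℝ) ^ 2) +
        Real.exp (-r) * (1 / (4 * r) - 3 / (4 * (r : ℝ) ^ 2)) := by
  have hr' : (r : ℝ) ≠ 0 := by positivity
  have h1 := hM.hasSum_moment 2
  rw [show momentCoeff r 2 = _ from funext (momentCoeff_two hr')] at h1
  have h2 := ((hasSum_exp_shift r 1).sub ((hasSum_exp_shift r 2).mul_left (1 / (r : ℝ)))).add
    ((hasSum_exp_shift r 3).mul_left (3 / (4 * (r : ℝ) ^ 2)))
  have h3 := h1.unique h2
  have hG : Real.Gamma (1 / 2 + (2 : ℕ)) / (√Real.pi * Real.Gamma (1 + (2 : ℕ))) = 3 / 8 := by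
    rw [show (1 / 2 + (2 : ℕ) : ℝ) = 5 / 2 by norm_num, Gamma_five_halves,
      show (1 + (2 : ℕ) : ℝ) = (2 : ℕ) + 1 by norm_num, Real.Gamma_nat_eq_factorial]
    norm_num [Nat.factorial]
    field_simp
    norm_num
  rw [hG] at h3
  simp only [Finset.sum_range_succ, Finset.sum_range_zero, Nat.factorial] at h3
  rw [Real.exp_neg]
  have hE := Real.exp_pos (r : ℝ)
  set E := Real.exp (r : ℝ)
  set m := ∫ ω, lastZero (resetProcess W N) ω ^ 2 ∂P
  refine mul_left_cancel₀ hE.ne' ?_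
  rw [sub_eq_iff_eq_add.1 h3]
  field_simp
  push_cast
  ring

theorem IsResettingModel.variance_lastZero (hM : IsResettingModel W N r P) :
    variance (lastZero (resetProcess W N)) P =
      ∫ ω, lastZero (resetProcess W N) ω ^ 2 ∂P -
        (∫ ω, lastZero (resetProcess W N) ω ∂P) ^ 2 := by
  have := hM.poisson.isProbabilityMeasure
  refine variance_eq_sub ?_
  refine MemLp.of_bound hM.aemeasurable_lastZero.aestronglyMeasurable 1 (ae_of_all _ fun ω ↦ ?_)
  rw [Real.norm_of_nonneg (lastZero_nonneg _ _)]
  exact lastZero_le_one _ _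

theorem IsResettingModel.integral_sq_sub (hM : IsResettingModel W N r P) (hr : 0 < r) :
    ∫ ω, lastZero (resetProcess W N) ω ^ 2 ∂P -
        (∫ ω, lastZero (resetProcess W N) ω ∂P) ^ 2 =
      (2 - Real.exp (-r) * (1 + 3 * r) - Real.exp (-(2 * r))) / (4 * (r : ℝ) ^ 2) := by
  have hr' : (r : ℝ) ≠ 0 := by positivity
  rw [hM.integral_lastZero_sq hr, hM.integral_lastZero hr,
    show (-(2 * r) : ℝ) = -r + -r by ring, Real.exp_add]
  field_simp
  ring

/-- The fraction is half the difference quotient of exp(-x) at 0, whose limit is -1. -/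
lemma tendsto_mean_zero :
    Tendsto (fun r : ℝ≥0 ↦ 1 + (Real.exp (-r) - 1) / (2 * (r : ℝ))) (𝓝[>] 0) (𝓝 (1 / 2)) := by
  have h1 : HasDerivAt (fun x : ℝ ↦ Real.exp (-x)) (-1) 0 := by
    simpa using (hasDerivAt_neg (0 : ℝ)).exp
  have h2 := hasDerivAt_iff_tendsto_slope.1 h1
  have h3 : Tendsto (fun r : ℝ≥0 ↦ (r : ℝ)) (𝓝[>] 0) (𝓝[≠] 0) := by
    refine tendsto_nhdsWithin_iff.2 ⟨?_, ?_⟩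
    · exact (NNReal.continuous_coe.tendsto 0).mono_left nhdsWithin_le_nhds
    · filter_upwards [self_mem_nhdsWithin] with r hr
      exact (NNReal.coe_pos.2 hr).ne'
  have h4 := ((h2.comp h3).const_mul (1 / 2)).const_add 1
  rw [show (1 : ℝ) + 1 / 2 * -1 = 1 / 2 by norm_num] at h4
  refine h4.congr fun r ↦ ?_
  simp only [Function.comp_apply, slope_def_field, neg_zero, Real.exp_zero, sub_zero]
  rw [div_mul_div_comm, one_mul]

lemma tendsto_exp_neg_coe : Tendsto (fun r : ℝ≥0 ↦ Real.exp (-(r : ℝ))) atTop (𝓝 0) :=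
  (Real.tendsto_exp_neg_atTop_nhds_zero).comp (NNReal.tendsto_coe_atTop.2 tendsto_id)

lemma tendsto_inv_coe : Tendsto (fun r : ℝ≥0 ↦ (r : ℝ)⁻¹) atTop (𝓝 0) :=
  tendsto_inv_atTop_zero.comp (NNReal.tendsto_coe_atTop.2 tendsto_id)

lemma tendsto_mean_atTop :
    Tendsto (fun r : ℝ≥0 ↦ 1 + (Real.exp (-r) - 1) / (2 * (r : ℝ))) atTop (𝓝 1) := by
  have h := (((tendsto_exp_neg_coe.sub_const 1).mul (tendsto_inv_coe.const_mul (1 / 2))).const_add 1)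
  simp only [mul_zero, add_zero] at h
  refine h.congr fun r ↦ ?_
  rw [div_eq_mul_inv _ (2 * (r : ℝ)), mul_inv]
  ring

lemma tendsto_variance_atTop :
    Tendsto (fun r : ℝ≥0 ↦ (2 - Real.exp (-r) * (1 + 3 * r) - Real.exp (-(2 * r))) /
      (4 * (r : ℝ) ^ 2)) atTop (𝓝 0) := by
  have h1 : Tendsto (fun r : ℝ≥0 ↦ (r : ℝ) ^ 1 * Real.exp (-(r : ℝ))) atTop (𝓝 0) :=
    (Real.tendsto_pow_mul_exp_neg_atTop_nhds_zero 1).comp (NNReal.tendsto_coe_atTop.2 tendsto_id)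
  have h2 := ((((tendsto_exp_neg_coe.add (h1.const_mul 3)).add
    (tendsto_exp_neg_coe.mul tendsto_exp_neg_coe)).const_sub 2).mul
    ((tendsto_inv_coe.mul tendsto_inv_coe).const_mul (1 / 4)))
  simp only [mul_zero] at h2
  refine h2.congr fun r ↦ ?_
  rw [show (-(2 * r) : ℝ) = -r + -r by ring, Real.exp_add,
    div_eq_mul_inv _ (4 * (r : ℝ) ^ 2), mul_inv, sq, mul_inv]
  ring

end MeanAndVariance

end BrownianResetting


/-! ### Assembly of the moment formulas and limits. -/

theorem mainTheorem5 :
    -- moments, mean and variance, for each fixed intensity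
    (∀ {Ω : Type*} [MeasurableSpace Ω] (P : Measure Ω) (r : ℝ≥0) (W : ℕ → ℝ≥0 → Ω → ℝ)
      (N : ℝ≥0 → Ω → ℕ), 0 < r → BrownianResetting.IsResettingModel W N r P →
      ∀ L : Ω → ℝ, L = BrownianResetting.lastZero (BrownianResetting.resetProcess W N) →
      (∀ n : ℕ, Integrable (fun ω ↦ L ω ^ n) P ∧
        ((∫ ω, L ω ^ n ∂P : ℝ) : ℂ) =
          (Real.exp (-r) : ℂ) *
            ((Real.Gamma (1 / 2 + n) / (√Real.pi * Real.Gamma (1 + n)) : ℝ)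
              + ((r : ℝ) * Real.Gamma (3 / 2 + n) : ℝ) *
                Complex.regularizedHGFun {1, 3 / 2 + (n : ℂ)} {3 / 2, 2 + (n : ℂ)}
                  ((r : ℝ) : ℂ))) ∧
      Integrable L P ∧
      ∫ ω, L ω ∂P = 1 + (Real.exp (-r) - 1) / (2 * r) ∧
      variance L P = ∫ ω, L ω ^ 2 ∂P - (∫ ω, L ω ∂P) ^ 2 ∧
      ∫ ω, L ω ^ 2 ∂P - (∫ ω, L ω ∂P) ^ 2 =
        (2 - Real.exp (-r) * (1 + 3 * r) - Real.exp (-(2 * r))) / (4 * (r : ℝ) ^ 2)) ∧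
    -- limits in the intensity; the spaces may depend on the intensity
    (∀ {Ω : ℝ≥0 → Type*} [∀ r, MeasurableSpace (Ω r)] (P : ∀ r, Measure (Ω r))
      (W : ∀ r, ℕ → ℝ≥0 → Ω r → ℝ) (N : ∀ r, ℝ≥0 → Ω r → ℕ),
      (∀ r : ℝ≥0, 0 < r → BrownianResetting.IsResettingModel (W r) (N r) r (P r)) →
      ∀ L : ∀ r, Ω r → ℝ,
      (∀ r, L r = BrownianResetting.lastZero (BrownianResetting.resetProcess (W r) (N r))) →
      Tendsto (fun r ↦ ∫ ω, L r ω ∂(P r)) (𝓝[>] 0) (𝓝 (1 / 2)) ∧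
      Tendsto (fun r ↦ ∫ ω, L r ω ∂(P r)) atTop (𝓝 1) ∧
      Tendsto (fun r ↦ variance (L r) (P r)) atTop (𝓝 0) ∧
      ∀ ε : ℝ, 0 < ε → Tendsto (fun r ↦ P r {ω | ε ≤ |L r ω - 1|}) atTop (𝓝 0)) := by
  refine ⟨?_, ?_⟩
  · rintro Ω _ P r W N hr hM L rfl
    exact ⟨fun n ↦ ⟨hM.integrable_pow n, hM.moment_eq n⟩,
      by simpa only [pow_one] using hM.integrable_pow 1, hM.integral_lastZero hr,
      hM.variance_lastZero, hM.integral_sq_sub hr⟩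
  · intro Ω _ P W N hM L hL
    obtain rfl : L = fun r ↦ BrownianResetting.lastZero
      (BrownianResetting.resetProcess (W r) (N r)) := funext hL
    have hmean : ∀ r : ℝ≥0, 0 < r → 1 + (Real.exp (-r) - 1) / (2 * (r : ℝ)) =
        ∫ ω, BrownianResetting.lastZero (BrownianResetting.resetProcess (W r) (N r)) ω ∂(P r) :=
      fun r hr ↦ ((hM r hr).integral_lastZero hr).symm
    have hmean_atTop := BrownianResetting.tendsto_mean_atTop.congr'
      ((eventually_gt_atTop 0).mono hmean)
    refine ⟨BrownianResetting.tendsto_mean_zero.congr' ?_, hmean_atTop,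
      BrownianResetting.tendsto_variance_atTop.congr' ?_, fun ε hε ↦ ?_⟩
    · filter_upwards [self_mem_nhdsWithin] with r hr using hmean r hr
    · filter_upwards [eventually_gt_atTop 0] with r hr
      rw [(hM r hr).variance_lastZero, (hM r hr).integral_sq_sub hr]
    -- Since L ≤ 1, the deviation |L - 1| is 1 - L, and Markov's inequality bounds its tail by (1 -
    -- E[L])/ε. Only the convergence of the mean is used.
    · have hlim := ENNReal.tendsto_ofReal ((hmean_atTop.const_sub 1).div_const ε)
      rw [sub_self, zero_div, ENNReal.ofReal_zero] at hlim
      refine tendsto_of_tendsto_of_tendsto_of_le_of_le' tendsto_const_nhds hlim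
        (Eventually.of_forall fun _ ↦ zero_le) ?_
      filter_upwards [eventually_gt_atTop 0] with r hr
      have := (hM r hr).poisson.isProbabilityMeasure
      have hint : Integrable (BrownianResetting.lastZero
          (BrownianResetting.resetProcess (W r) (N r))) (P r) := by
        simpa only [pow_one] using (hM r hr).integrable_pow 1
      have habs : ∀ ω, |BrownianResetting.lastZero
          (BrownianResetting.resetProcess (W r) (N r)) ω - 1| = 1 - BrownianResetting.lastZero
          (BrownianResetting.resetProcess (W r) (N r)) ω := fun ω ↦ by
        rw [abs_sub_comm, abs_of_nonneg (sub_nonneg.2 (BrownianResetting.lastZero_le_one _ _))]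
      have h := mul_meas_ge_le_integral_of_nonneg (ae_of_all _ fun ω ↦
        sub_nonneg.2 (BrownianResetting.lastZero_le_one
          (BrownianResetting.resetProcess (W r) (N r)) ω))
        ((integrable_const (1 : ℝ)).sub hint) ε
      rw [integral_sub (integrable_const _) hint, integral_const, probReal_univ, one_smul] at h
      simp only [habs]
      rw [← ofReal_measureReal]
      exact ENNReal.ofReal_le_ofReal ((le_div_iff₀' hε).2 h)
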